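/- Let $k\ge -\tfrac12$, let $M=\begin{pmatrix}a&b\\c&d\end{pmatrix}\in SL(2,\mathbb R)$ with $b\neq 0$, and let $d\mu_k(x)=\frac{|x|^{2k+1}dx}{2^{k+1}\Gamma(k+1)}$, $L^2_k(\mathbb R)=L^2(\mathbb R,\mu_k)$, $\langle f,g\rangle_{L^2_k}=\int f\,\overline g\,d\mu_k$. Let $$j_\nu(z)=\Gamma(\nu+1)\sum_{n\ge0}\frac{(-1)^n(z/2)^{2n}}{n!\,\Gamma(n+\nu+1)},\qquad E_k(z,x)=j_k(izx)+\frac{zx}{2(k+1)}\,j_{k+1}(izx)$$ be the normalized Bessel function and the Dunkl kernel, and put $E_k^M(\lambda,x)=e^{\frac i2(\frac db\lambda^2+\frac ab x^2)}E_k(-i\lambda/b,x)$. The linear canonical Dunkl transform is $$D_k^Mf(\lambda)=\frac1{(ib)^{k+1}}\int_{\mathbb R} f(x)\,E_k^M(\lambda,x)\,d\mu_k(x)$$ (principal branch of the power) for $f\in L^1(\mathbb R,\mu_k)$, extended by duality to the tempered distributions $\mathcal S'(\mathbb R)$, where a function $F$ is identified with the distribution $\varphi\mapsto\int F\varphi\,d\mu_k$;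 thus $\langle D_k^Mf,\varphi\rangle=\langle f,D_k^{M'}\varphi\rangle$ for $\varphi\in\mathcal S(\mathbb R)$, with $M'=\begin{pmatrix}d&b\\c&a\end{pmatrix}$. For $s\in\mathbb R$ let $$W^s_{k,M}(\mathbb R)=\{f\in\mathcal S'(\mathbb R):(1+\lambda^2)^{s/2}D_k^Mf(\lambda)\in L^2_k(\mathbb R)\},\qquad \langle f,g\rangle_{W^s_{k,M}}=\int_{\mathbb R}(1+\lambda^2)^s\,D_k^Mf(\lambda)\,\overline{D_k^Mg(\lambda)}\,d\mu_k(\lambda).$$ **Theorem.** Let $s>\frac{k+1}2$, $\rho>0$ and $g\in L^2_k(\mathbb R)$. For every $y\in\mathbb R$ the formula $$\mathcal K_{s,\rho}(x,y)=\frac1{|b|^{2k+2}}\int_{\mathbb R}\frac{E_k^M(\lambda,y)\,\overline{E_k^M(\lambda,x)}}{\rho(1+\lambda^2)^s+1}\,d\mu_k(\lambda)$$ defines a function $\mathcal K_{s,\rho}(\cdot,y)\in L^2_k(\mathbb R)$, the integral being the $L^2_k$-limit, as $R\to\infty$, of the integrals over $[-R,R]$; its transform $D_k^M(\mathcal K_{s,\rho}(\cdot,y))$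 is in $L^2_k(\mathbb R)$; and if $s>k+1$, then $\mathcal K_{s,\rho}$ is the reproducing kernel of $W^s_{k,M}(\mathbb R)$ with the inner product $\rho\langle f,h\rangle_{W^s_{k,M}}+\langle D_k^Mf,D_k^Mh\rangle_{L^2_k}$ (the elements of $W^s_{k,M}(\mathbb R)$ being continuous functions in that case). There is a unique $h^*_{\rho,g}\in W^s_{k,M}(\mathbb R)$ at which the infimum $$\inf_{f\in W^s_{k,M}(\mathbb R)}\left\{\rho\|f\|^2_{W^s_{k,M}}+\|g-D_k^Mf\|^2_{L^2_k}\right\}$$ is attained. It is a continuous function, and $$h^*_{\rho,g}(y)=\big\langle g,\,D_k^M(\mathcal K_{s,\rho}(\cdot,y))\big\rangle_{L^2_k}\qquad\text{for all }y\in\mathbb R.$$ -/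

import Mathlib

open MeasureTheory Filter Topology
open scoped SchwartzMap ENNReal

namespace LCDT

noncomputable section

/-- The measure `dμ_k(x) = |x|^(2k+1) dx / (2^(k+1) Γ(k+1))` on `ℝ`. -/
def dunklMeasure (k : ℝ) : Measure ℝ :=
  volume.withDensity fun x =>
    ENNReal.ofReal (|x| ^ (2 * k + 1) / (2 ^ (k + 1) * Real.Gamma (k + 1)))

/-- The normalized (entire) Bessel function
`j_ν(z) = Γ(ν+1) ∑ (-1)^n (z/2)^(2n) / (n! Γ(n+ν+1))`. -/
def normalizedBessel (ν : ℝ) (z : ℂ) : ℂ :=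
  (Real.Gamma (ν + 1) : ℂ) *
    ∑' n : ℕ, (-1) ^ n * (z / 2) ^ (2 * n) / ((n.factorial : ℂ) * (Real.Gamma (n + ν + 1) : ℂ))

/-- The one-dimensional Dunkl kernel
`E_k(z, x) = j_k(i z x) + (z x / (2(k+1))) j_(k+1)(i z x)`; it is `exp (z x)` for `k = -1/2`. -/
def dunklKernel (k : ℝ) (z : ℂ) (x : ℝ) : ℂ :=
  normalizedBessel k (Complex.I * (z * x)) +
    z * x / (2 * (k + 1)) * normalizedBessel (k + 1) (Complex.I * (z * x))

/-- The linear canonical Dunkl kernel, for `M = (a, b; c, d)`: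
`E_k^M(l, x) = exp ((i/2) ((d/b) l^2 + (a/b) x^2)) E_k(-i l / b, x)`. -/
def lcdtKernel (k : ℝ) (M : Matrix.SpecialLinearGroup (Fin 2) ℝ) (l x : ℝ) : ℂ :=
  Complex.exp (Complex.I / 2 *
      ((M 1 1 / M 0 1 * l ^ 2 + M 0 0 / M 0 1 * x ^ 2 : ℝ) : ℂ)) *
    dunklKernel k (-Complex.I * l / M 0 1) x

/-- The linear canonical Dunkl transform of an integrable function,
`D_k^M f (l) = (i b)^(-(k+1)) ∫ f(x) E_k^M(l, x) dμ_k(x)`. -/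
def lcdt (k : ℝ) (M : Matrix.SpecialLinearGroup (Fin 2) ℝ) (f : ℝ → ℂ) (l : ℝ) : ℂ :=
  ((Complex.I * M 0 1) ^ ((k : ℂ) + 1))⁻¹ *
    ∫ x, f x * lcdtKernel k M l x ∂(dunklMeasure k)

/-- The matrix `(d, b; c, a)` for `M = (a, b; c, d)`. -/
def swapDiag (M : Matrix.SpecialLinearGroup (Fin 2) ℝ) : Matrix.SpecialLinearGroup (Fin 2) ℝ :=
  ⟨!![M 1 1, M 0 1; M 1 0, M 0 0], by
    have h := M.det_coe
    rw [Matrix.det_fin_two] at h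
    rw [Matrix.det_fin_two_of]
    linarith⟩

/-- Transposing the kernel of `D_k^M` gives the kernel of the transform of `swapDiag M`. Hence
`∫ (D_k^M f) φ dμ_k = ∫ f (D_k^(swapDiag M) φ) dμ_k` by Fubini, and the extension of `D_k^M` to
tempered distributions is the transpose of `D_k^(swapDiag M)` on the Schwartz space. -/
theorem lcdtKernel_swapDiag (k : ℝ) (M : Matrix.SpecialLinearGroup (Fin 2) ℝ) (l x : ℝ) :
    lcdtKernel k (swapDiag M) x l = lcdtKernel k M l x := by
  simp only [lcdtKernel, swapDiag, dunklKernel]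
  simp only [Matrix.of_apply, Matrix.cons_val_zero,
    Matrix.cons_val_one, Matrix.cons_val', Matrix.cons_val_fin_one]
  have e : -Complex.I * (x : ℂ) / (M 0 1 : ℂ) * (l : ℂ) =
      -Complex.I * (l : ℂ) / (M 0 1 : ℂ) * (x : ℂ) := by ring
  rw [e, add_comm (M 0 0 / M 0 1 * x ^ 2)]

/-- The tempered distribution `T` is (given by) the function `F`, where functions are identified
with distributions through `φ ↦ ∫ F φ dμ_k`. -/
def IsFunction (k : ℝ) (T : 𝓢'(ℝ, ℂ)) (F : ℝ → ℂ) : Prop :=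
  ∀ φ : 𝓢(ℝ, ℂ), Integrable (fun x => F x * φ x) (dunklMeasure k) ∧
    T φ = ∫ x, F x * φ x ∂(dunklMeasure k)

/-- The linear canonical Dunkl transform of the tempered distribution `T`, defined by duality as
`⟨D_k^M T, φ⟩ = ⟨T, D_k^(swapDiag M) φ⟩` for Schwartz functions `φ`, is the function `u`.
(Here `ψ` is the Schwartz function `D_k^(swapDiag M) φ`.) -/
def HasLCDT (k : ℝ) (M : Matrix.SpecialLinearGroup (Fin 2) ℝ) (T : 𝓢'(ℝ, ℂ)) (u : ℝ → ℂ) :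
    Prop :=
  ∀ φ : 𝓢(ℝ, ℂ), Integrable (fun x => u x * φ x) (dunklMeasure k) ∧
    ∀ ψ : 𝓢(ℝ, ℂ), (∀ x, ψ x = lcdt k (swapDiag M) φ x) →
      T ψ = ∫ x, u x * φ x ∂(dunklMeasure k)

open Classical in
/-- The function `D_k^M T`, for a tempered distribution `T` whose transform is a function (it is
then unique up to a null set). -/
def lcdtFun (k : ℝ) (M : Matrix.SpecialLinearGroup (Fin 2) ℝ) (T : 𝓢'(ℝ, ℂ)) : ℝ → ℂ :=
  if h : ∃ u, HasLCDT k M T u then h.choose else 0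

/-- The space `W^s_(k,M)(ℝ)` of all tempered distributions `T` such that
`(1 + l^2)^(s/2) D_k^M T (l)` is in `L²_k(ℝ)`. -/
def sobolevSpace (k : ℝ) (M : Matrix.SpecialLinearGroup (Fin 2) ℝ) (s : ℝ) : Set 𝓢'(ℝ, ℂ) :=
  {T | ∃ u, HasLCDT k M T u ∧
    MemLp (fun l : ℝ => (((1 + l ^ 2) ^ (s / 2) : ℝ) : ℂ) * u l) 2 (dunklMeasure k)}

/-- `⟨f, g⟩ = ∫ f conj(g) dμ_k` on `L²_k(ℝ)`. -/
def l2Inner (k : ℝ) (f g : ℝ → ℂ) : ℂ :=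
  ∫ x, f x * starRingEnd ℂ (g x) ∂(dunklMeasure k)

/-- `‖f‖ = (∫ |f|² dμ_k)^(1/2)` on `L²_k(ℝ)`. -/
def l2Norm (k : ℝ) (f : ℝ → ℂ) : ℝ :=
  Real.sqrt (∫ x, ‖f x‖ ^ 2 ∂(dunklMeasure k))

/-- `⟨S, T⟩ = ∫ (1 + l^2)^s D_k^M S(l) conj(D_k^M T(l)) dμ_k(l)` on `W^s_(k,M)(ℝ)`. -/
def sobolevInner (k : ℝ) (M : Matrix.SpecialLinearGroup (Fin 2) ℝ) (s : ℝ)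
    (S T : 𝓢'(ℝ, ℂ)) : ℂ :=
  ∫ l : ℝ, (((1 + l ^ 2) ^ s : ℝ) : ℂ) * lcdtFun k M S l * starRingEnd ℂ (lcdtFun k M T l)
    ∂(dunklMeasure k)

/-- The norm `‖T‖ = ⟨T, T⟩^(1/2)` on `W^s_(k,M)(ℝ)`. -/
def sobolevNorm (k : ℝ) (M : Matrix.SpecialLinearGroup (Fin 2) ℝ) (s : ℝ) (T : 𝓢'(ℝ, ℂ)) : ℝ :=
  Real.sqrt (sobolevInner k M s T T).re

/-- The functional `f ↦ ρ ‖f‖²_(W^s) + ‖g - D_k^M f‖²_(L²_k)`. -/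
def tikhonov (k : ℝ) (M : Matrix.SpecialLinearGroup (Fin 2) ℝ) (s ρ : ℝ) (g : ℝ → ℂ)
    (f : 𝓢'(ℝ, ℂ)) : ℝ :=
  ρ * sobolevNorm k M s f ^ 2 + l2Norm k (fun l => g l - lcdtFun k M f l) ^ 2

/-- `h` is in `W^s_(k,M)(ℝ)`, and the infimum of the functional over that space is attained
at `h`. -/
def IsExtremal (k : ℝ) (M : Matrix.SpecialLinearGroup (Fin 2) ℝ) (s ρ : ℝ) (g : ℝ → ℂ)
    (h : 𝓢'(ℝ, ℂ)) : Prop :=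
  h ∈ sobolevSpace k M s ∧ IsMinOn (tikhonov k M s ρ g) (sobolevSpace k M s) h

/-- The inner product `ρ ⟨S, T⟩_(W^s) + ⟨D_k^M S, D_k^M T⟩_(L²_k)` on `W^s_(k,M)(ℝ)`. -/
def regInner (k : ℝ) (M : Matrix.SpecialLinearGroup (Fin 2) ℝ) (s ρ : ℝ)
    (S T : 𝓢'(ℝ, ℂ)) : ℂ :=
  (ρ : ℂ) * sobolevInner k M s S T + l2Inner k (lcdtFun k M S) (lcdtFun k M T)

/-- The integral over `|l| ≤ R` in the formula
`K_(s,ρ)(x, y) = |b|^(-(2k+2)) ∫ E_k^M(l, y) conj(E_k^M(l, x)) / (ρ (1 + l^2)^s + 1) dμ_k(l)`. -/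
def truncatedKernel (k : ℝ) (M : Matrix.SpecialLinearGroup (Fin 2) ℝ) (s ρ R x y : ℝ) : ℂ :=
  ((1 / |M 0 1| ^ (2 * k + 2) : ℝ) : ℂ) *
    ∫ l in Set.Icc (-R) R, lcdtKernel k M l y * starRingEnd ℂ (lcdtKernel k M l x) /
      ((ρ * (1 + l ^ 2) ^ s + 1 : ℝ) : ℂ) ∂(dunklMeasure k)

/-- `T` is the kernel section `K_(s,ρ)(·, y)`: the element of `L²_k(ℝ)` given by the integral
formula for the kernel, the integral over `ℝ` being the `L²_k`-limit of the integrals over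
`[-R, R]`. -/
def IsKernelSection (k : ℝ) (M : Matrix.SpecialLinearGroup (Fin 2) ℝ) (s ρ y : ℝ)
    (T : 𝓢'(ℝ, ℂ)) : Prop :=
  ∃ F : ℝ → ℂ, MemLp F 2 (dunklMeasure k) ∧
    Tendsto (fun R : ℝ =>
      eLpNorm (fun x => truncatedKernel k M s ρ R x y - F x) 2 (dunklMeasure k)) atTop (𝓝 0) ∧
    IsFunction k T F

/-- The family `κ y = K(·, y)` is the reproducing kernel of `W^s_(k,M)(ℝ)` with the inner product
`regInner`: every `f` in the space is a continuous function, with `f(y) = ⟨f, K(·, y)⟩`. -/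
def IsReproducingKernel (k : ℝ) (M : Matrix.SpecialLinearGroup (Fin 2) ℝ) (s ρ : ℝ)
    (κ : ℝ → 𝓢'(ℝ, ℂ)) : Prop :=
  (∀ y, κ y ∈ sobolevSpace k M s) ∧
    ∀ f ∈ sobolevSpace k M s, ∃ F : ℝ → ℂ, Continuous F ∧ IsFunction k f F ∧
      ∀ y, F y = regInner k M s ρ f (κ y)

end

end LCDT

open scoped ContDiff

namespace LCDT

/-! On the transform side every object becomes a multiplier. Write C = (ib)^(-(k+1)) and m(l) =
ρ(1+l²)^s + 1. The kernel section at y is the distribution with transform v_y(l) = C E^M(l,y)/m(l).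
Since |E^M| ≤ 1, and 1/m is in L²_k for s > (k+1)/2, v_y is in L²_k; the L² contraction of the
inverse transform turns truncation of v_y into convergence of the truncated kernels. In the
regularized inner product the weight is m, which cancels the denominator of v_y and leaves the
inversion integral of f at y; for s > k+1 that integral converges absolutely
(`isReproducingKernel_of_hasLCDT`).

For the functional, put u = D_k^M f and complete the square pointwise: ρ(1+l²)^s|u|² + |g-u|² = m|u
- g/m|² + |g|² - |g|²/m. The only minimizer therefore has transform g/m (`tikhonov_eq`,
`isExtremal_of_hasLCDT`). As a product of two L² functions g/m is integrable, even when s ≤ k+1, so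
the minimizer is a continuous inversion integral, and its value at y is ⟨g, v_y⟩.

The rest is the harmonic analysis behind these manipulations, built from the Bessel series. An
energy estimate (`realBessel_sq_add_le_one`) bounds the kernel by 1. The Euler and Dunkl operators
intertwine with the Dunkl transform, which gives invariance of the Schwartz space
(`exists_schwartz_dunklTransform`). Inversion (`dunklTransform_dunklTransform`) follows from the
intertwining relations, the fixed Gaussian and division by x - a. The canonical transform is the
Dunkl transform composed with chirps, a dilation and a constant, so it inherits inversion; Parseval
and density carry the inverse to L²_k, and bijectivity on Schwartz functions gives uniqueness for
tempered distributions. -/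

/-! ### Bessel series, contiguous relations and the energy bound -/

/-- The coefficient of `x ^ (2 * n)` in the normalized Bessel function of order `ν`. -/
noncomputable def besselCoeff (ν : ℝ) (n : ℕ) : ℝ :=
  Real.Gamma (ν + 1) * ((-1) ^ n / (4 ^ n * n.factorial * Real.Gamma (n + ν + 1)))

/-- The normalized Bessel function on the real line. -/
noncomputable def realBessel (ν x : ℝ) : ℝ := ∑' n : ℕ, besselCoeff ν n * x ^ (2 * n)

theorem normalizedBessel_ofReal (ν x : ℝ) :
    normalizedBessel ν (x : ℂ) = (realBessel ν x : ℂ) := by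
  rw [normalizedBessel, realBessel, ← tsum_mul_left, Complex.ofReal_tsum]
  refine tsum_congr fun n => ?_
  simp only [besselCoeff]
  push_cast
  rw [div_pow, pow_mul (2 : ℂ)]
  norm_num
  ring

theorem besselCoeff_zero {ν : ℝ} (hν : -1 / 2 ≤ ν) : besselCoeff ν 0 = 1 := by
  have : Real.Gamma (ν + 1) ≠ 0 := (Real.Gamma_pos_of_pos (by linarith)).ne'
  simp [besselCoeff, this]

theorem besselCoeff_order_succ {ν : ℝ} (hν : -1 / 2 ≤ ν) (n : ℕ) :
    besselCoeff (ν + 1) n * (n + ν + 1) = (ν + 1) * besselCoeff ν n := by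
  have h0 : (0 : ℝ) < n + ν + 1 := by have := n.cast_nonneg (α := ℝ); linarith
  have hG : Real.Gamma (n + ν + 1) ≠ 0 := (Real.Gamma_pos_of_pos h0).ne'
  simp only [besselCoeff]
  rw [Real.Gamma_add_one (s := ν + 1) (by linarith),
    show (n : ℝ) + (ν + 1) + 1 = (n + ν + 1) + 1 by ring, Real.Gamma_add_one h0.ne']
  field_simp

theorem besselCoeff_succ {ν : ℝ} (hν : -1 / 2 ≤ ν) (n : ℕ) :
    besselCoeff ν (n + 1) * (4 * (n + 1) * (n + ν + 1)) = -besselCoeff ν n := by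
  have h0 : (0 : ℝ) < n + ν + 1 := by have := n.cast_nonneg (α := ℝ); linarith
  have hG : Real.Gamma (n + ν + 1) ≠ 0 := (Real.Gamma_pos_of_pos h0).ne'
  simp only [besselCoeff]
  rw [show ((n + 1 : ℕ) : ℝ) + ν + 1 = (n + ν + 1) + 1 by push_cast; ring,
    Real.Gamma_add_one h0.ne', Nat.factorial_succ, pow_succ, pow_succ]
  push_cast
  have : (n.factorial : ℝ) ≠ 0 := by positivity
  field_simp

/-- Consecutive coefficients have ratio of modulus 1/(4(n+1)(n+ν+1)), and 4(n+ν+1) ≥ 2 for ν ≥ -1/2.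
Domination by the exponential series in x² is all that is needed later. -/
theorem abs_besselCoeff_le {ν : ℝ} (hν : -1 / 2 ≤ ν) (n : ℕ) :
    |besselCoeff ν n| ≤ 1 / n.factorial := by
  induction n with
  | zero => simp [besselCoeff_zero hν]
  | succ n ih =>
    have hn := n.cast_nonneg (α := ℝ)
    have h0 : (0 : ℝ) < n + ν + 1 := by linarith
    have h := congrArg abs (besselCoeff_succ hν n)
    rw [abs_neg, abs_mul, abs_of_pos (by positivity : (0 : ℝ) < 4 * (n + 1) * (n + ν + 1))] at h
    have h1 : |besselCoeff ν (n + 1)| * (n + 1) ≤ |besselCoeff ν n| := by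
      rw [← h]
      gcongr
      nlinarith
    rw [Nat.factorial_succ]
    push_cast
    rw [← div_div, div_right_comm, le_div_iff₀ (by positivity)]
    exact h1.trans ih

theorem summable_realBessel {ν : ℝ} (hν : -1 / 2 ≤ ν) (x : ℝ) :
    Summable fun n : ℕ => besselCoeff ν n * x ^ (2 * n) := by
  refine Summable.of_norm_bounded (Real.summable_pow_div_factorial (x ^ 2)) fun n => ?_
  rw [Real.norm_eq_abs, abs_mul, pow_mul, abs_of_nonneg (by positivity : 0 ≤ (x ^ 2) ^ n)]
  have := mul_le_mul_of_nonneg_right (abs_besselCoeff_le hν n) (by positivity : 0 ≤ (x ^ 2) ^ n)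
  rwa [one_div_mul_eq_div] at this

theorem hasDerivAt_realBessel {ν : ℝ} (hν : -1 / 2 ≤ ν) (x : ℝ) :
    HasDerivAt (realBessel ν) (-(x * realBessel (ν + 1) x) / (2 * (ν + 1))) x := by
  have hν1 : 0 < ν + 1 := by linarith
  have key : ∀ n : ℕ, besselCoeff ν (n + 1) * (2 * (n + 1)) =
      -besselCoeff (ν + 1) n / (2 * (ν + 1)) := by
    intro n
    have h0 : (0 : ℝ) < n + ν + 1 := by have := n.cast_nonneg (α := ℝ); linarith
    have h1 := besselCoeff_succ hν n
    have h2 := besselCoeff_order_succ hν n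
    rw [eq_div_iff (by positivity)]
    apply mul_right_cancel₀ h0.ne'
    linear_combination (ν + 1) * h1 + h2
  -- The constant term is split off so that the derivative of the term of degree 2(n+1) is, by
  -- `key`, exactly the n-th term of the series of order ν + 1.
  have h1 : realBessel ν = fun y => ∑' n : ℕ, besselCoeff ν (n + 1) * y ^ (2 * (n + 1)) + 1 := by
    funext y
    rw [realBessel, (summable_realBessel hν y).tsum_eq_zero_add, besselCoeff_zero hν]
    simp [add_comm]
  rw [h1]
  have hx : x ∈ Metric.ball (0 : ℝ) (|x| + 1) := by simp
  have hder := hasDerivAt_tsum_of_isPreconnected (𝕜 := ℝ)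
    (g := fun (n : ℕ) y => besselCoeff ν (n + 1) * y ^ (2 * (n + 1)))
    (g' := fun n y => -(y * (besselCoeff (ν + 1) n * y ^ (2 * n))) / (2 * (ν + 1)))
    (u := fun n => (|x| + 1) * (((|x| + 1) ^ 2) ^ n / n.factorial))
    (t := Metric.ball (0 : ℝ) (|x| + 1)) (y₀ := x) (y := x)
    ((Real.summable_pow_div_factorial _).mul_left _) Metric.isOpen_ball
    (convex_ball _ _).isPreconnected ?_ ?_ hx
    ((summable_nat_add_iff 1).2 (summable_realBessel hν x)) hx
  · have := hder.add_const 1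
    refine this.congr_deriv ?_
    simp only [realBessel]
    rw [tsum_div_const, tsum_neg, tsum_mul_left]
  · intro n y _
    refine ((hasDerivAt_pow (2 * (n + 1)) y).const_mul _).congr_deriv ?_
    have := key n
    rw [show 2 * (n + 1) - 1 = 2 * n + 1 by omega]
    push_cast
    rw [pow_succ]
    linear_combination (y ^ (2 * n) * y) * this
  · intro n y hy
    have hy' : |y| ≤ |x| + 1 := by simpa using (mem_ball_zero_iff.1 hy).le
    rw [norm_div, norm_neg, norm_mul, norm_mul, Real.norm_eq_abs, Real.norm_eq_abs,
      Real.norm_eq_abs, Real.norm_eq_abs, abs_of_pos (by positivity : 0 < 2 * (ν + 1)), abs_pow,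
      pow_mul]
    have hb := abs_besselCoeff_le (ν := ν + 1) (by linarith) n
    refine (div_le_self (by positivity) (by linarith)).trans ?_
    rw [div_eq_inv_mul _ (n.factorial : ℝ), ← one_div]
    gcongr

/-- Coefficient comparison: by the one-step relations all coefficients of x^(2(n+1)) are rational
multiples of `besselCoeff ν n`. This is the Bessel equation in contiguous form, and it yields the
first-order relation `mul_deriv_besselRatio`. -/
theorem realBessel_recurrence {ν : ℝ} (hν : -1 / 2 ≤ ν) (x : ℝ) :
    realBessel (ν + 1) x - x ^ 2 * realBessel (ν + 1 + 1) x / (4 * (ν + 1) * (ν + 1 + 1)) =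
      realBessel ν x := by
  have hν1 : 0 < ν + 1 := by linarith
  have hν' : -1 / 2 ≤ ν + 1 := by linarith
  have key : ∀ n : ℕ, besselCoeff (ν + 1) (n + 1) * x ^ (2 * (n + 1)) -
      x ^ 2 * (besselCoeff (ν + 1 + 1) n * x ^ (2 * n)) / (4 * (ν + 1) * (ν + 1 + 1)) =
      besselCoeff ν (n + 1) * x ^ (2 * (n + 1)) := by
    intro n
    have hn := n.cast_nonneg (α := ℝ)
    have h0 : (0 : ℝ) < n + ν + 1 := by linarith
    have h1 := besselCoeff_succ hν n
    have h2 := besselCoeff_succ hν' n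
    have h3 := besselCoeff_order_succ hν' n
    have h4 := besselCoeff_order_succ hν n
    have h5 : besselCoeff (ν + 1) (n + 1) - besselCoeff (ν + 1 + 1) n / (4 * (ν + 1) * (ν + 1 + 1))
        = besselCoeff ν (n + 1) := by
      have e1 : besselCoeff ν (n + 1) = -besselCoeff ν n / (4 * (n + 1) * (n + ν + 1)) := by
        rw [eq_div_iff (by positivity), h1]
      have e2 : besselCoeff (ν + 1) (n + 1) =
          -besselCoeff (ν + 1) n / (4 * (n + 1) * (n + (ν + 1) + 1)) := by
        rw [eq_div_iff (by positivity), h2]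
      have e3 : besselCoeff (ν + 1 + 1) n =
          (ν + 1 + 1) * besselCoeff (ν + 1) n / (n + (ν + 1) + 1) := by
        rw [eq_div_iff (by positivity), h3]
      have e4 : besselCoeff (ν + 1) n = (ν + 1) * besselCoeff ν n / (n + ν + 1) := by
        rw [eq_div_iff (by positivity), h4]
      rw [e1, e2, e3, e4]
      field_simp
      ring
    rw [← h5]
    ring
  have s0 := summable_realBessel hν x
  have s1 := summable_realBessel hν' x
  have s2 := summable_realBessel (ν := ν + 1 + 1) (by linarith) x
  simp only [realBessel]
  rw [s1.tsum_eq_zero_add, s0.tsum_eq_zero_add, besselCoeff_zero hν, besselCoeff_zero hν',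
    ← tsum_congr key, ← tsum_mul_left, ← tsum_div_const, Summable.tsum_sub]
  · ring
  · exact (summable_nat_add_iff 1).2 s1
  · exact (s2.mul_left _).div_const _

theorem realBessel_neg (ν x : ℝ) : realBessel ν (-x) = realBessel ν x := by
  simp [realBessel, pow_mul]

theorem realBessel_zero {ν : ℝ} (hν : -1 / 2 ≤ ν) : realBessel ν 0 = 1 := by
  rw [realBessel, tsum_eq_single 0]
  · simp [besselCoeff_zero hν]
  · intro n hn
    simp [hn]

/-- `besselRatio k x = j_(k+1)(x) / (2(k+1))`, so that `-x * besselRatio k x` is the derivative of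
`j_k`. -/
noncomputable def besselRatio (k x : ℝ) : ℝ := realBessel (k + 1) x / (2 * (k + 1))

theorem besselRatio_neg (k x : ℝ) : besselRatio k (-x) = besselRatio k x := by
  simp [besselRatio, realBessel_neg]

theorem hasDerivAt_realBessel' {k : ℝ} (hk : -1 / 2 ≤ k) (x : ℝ) :
    HasDerivAt (realBessel k) (-(x * besselRatio k x)) x := by
  refine (hasDerivAt_realBessel hk x).congr_deriv ?_
  rw [besselRatio]; ring

theorem hasDerivAt_besselRatio {k : ℝ} (hk : -1 / 2 ≤ k) (x : ℝ) :
    HasDerivAt (besselRatio k) (deriv (besselRatio k) x) x :=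
  ((hasDerivAt_realBessel (by linarith) x).div_const _).differentiableAt.hasDerivAt

theorem mul_deriv_besselRatio {k : ℝ} (hk : -1 / 2 ≤ k) (x : ℝ) :
    x * deriv (besselRatio k) x = realBessel k x - (2 * k + 2) * besselRatio k x := by
  have hd := ((hasDerivAt_realBessel (ν := k + 1) (by linarith) x).div_const (2 * (k + 1))).deriv
  have h1 : k + 1 ≠ 0 := by linarith
  have h2 : k + 1 + 1 ≠ 0 := by linarith
  rw [← realBessel_recurrence hk x, show besselRatio k = fun y => realBessel (k + 1) y / (2 * (k + 1))
    from rfl, hd]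
  field_simp
  ring

/-- The left side is an energy, equal to 1 at the origin, with derivative -2(2k+1) x `besselRatio k
x`², hence nonincreasing on x ≥ 0 because k ≥ -1/2; evenness covers x < 0. For k = -1/2 it reads
cos² + sin² = 1. -/
theorem realBessel_sq_add_le_one {k : ℝ} (hk : -1 / 2 ≤ k) (x : ℝ) :
    realBessel k x ^ 2 + (x * besselRatio k x) ^ 2 ≤ 1 := by
  let N : ℝ → ℝ := fun y => realBessel k y ^ 2 + (y * besselRatio k y) ^ 2
  have hN : ∀ y, HasDerivAt N (-(2 * (2 * k + 1) * y * besselRatio k y ^ 2)) y := by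
    intro y
    refine (((hasDerivAt_realBessel' hk y).pow 2).add
      (((hasDerivAt_id y).mul (hasDerivAt_besselRatio hk y)).pow 2)).congr_deriv ?_
    have h := mul_deriv_besselRatio hk y
    simp only [id]
    push_cast
    simp only [Pi.mul_apply, id]
    linear_combination (2 * y * besselRatio k y) * h
  have hanti : AntitoneOn N (Set.Ici 0) := by
    refine antitoneOn_of_deriv_nonpos (convex_Ici 0)
      (fun y _ => (hN y).continuousAt.continuousWithinAt)
      (fun y _ => (hN y).differentiableAt.differentiableWithinAt) fun y hy => ?_
    rw [interior_Ici, Set.mem_Ioi] at hy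
    rw [(hN y).deriv]
    have : 0 ≤ 2 * k + 1 := by linarith
    have : 0 ≤ 2 * (2 * k + 1) * y * besselRatio k y ^ 2 := by positivity
    linarith
  have hle : ∀ y, 0 ≤ y → N y ≤ 1 := fun y hy => by
    have := hanti Set.self_mem_Ici hy hy
    simpa [N, realBessel_zero hk] using this
  rcases le_total 0 x with hx | hx
  · exact hle x hx
  · have := hle (-x) (by linarith)
    simpa only [N, realBessel_neg, besselRatio_neg, neg_mul, neg_sq] using this

/-! ### Temperate growth of the Bessel functions and of the Dunkl kernel -/

theorem iteratedDeriv_sub_mul {f : ℝ → ℂ} (hf : ContDiff ℝ ∞ f) (a : ℝ) (n : ℕ) (x : ℝ) :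
    iteratedDeriv (n + 1) (fun y => ((y - a : ℝ) : ℂ) * f y) x =
      ((x - a : ℝ) : ℂ) * iteratedDeriv (n + 1) f x + (n + 1) * iteratedDeriv n f x := by
  have hd : ∀ n x, HasDerivAt (iteratedDeriv n f) (iteratedDeriv (n + 1) f x) x := by
    intro n x
    rw [iteratedDeriv_succ]
    exact ((hf.differentiable_iteratedDeriv n (by exact_mod_cast WithTop.coe_lt_top _)) x).hasDerivAt
  have hi : ∀ x, HasDerivAt (fun y : ℝ => ((y - a : ℝ) : ℂ)) 1 x := fun x => by
    simpa using ((hasDerivAt_id x).sub_const a).ofReal_comp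
  induction n generalizing x with
  | zero =>
    rw [zero_add, iteratedDeriv_one]
    refine ((hi x).mul (hd 0 x)).deriv.trans ?_
    simp
    ring
  | succ n ih =>
    rw [iteratedDeriv_succ, show iteratedDeriv (n + 1) (fun y => ((y - a : ℝ) : ℂ) * f y) = _ from
      funext ih]
    refine (((hi x).mul (hd (n + 1) x)).add ((hd n x).const_mul _)).deriv.trans ?_
    push_cast
    ring

theorem contDiff_realBessel {ν : ℝ} (hν : -1 / 2 ≤ ν) : ContDiff ℝ ∞ (realBessel ν) := by
  rw [contDiff_infty]
  intro n
  induction n generalizing ν with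
  | zero =>
    exact contDiff_zero.2 (continuous_iff_continuousAt.2 fun x =>
      (hasDerivAt_realBessel hν x).continuousAt)
  | succ n ih =>
    push_cast
    refine contDiff_succ_iff_deriv.2 ⟨fun x => (hasDerivAt_realBessel hν x).differentiableAt,
      by simp, ?_⟩
    rw [show deriv (realBessel ν) = _ from funext fun x => (hasDerivAt_realBessel hν x).deriv]
    exact ((contDiff_id.mul (ih (by linarith))).neg).div_const _

theorem contDiff_ofReal_realBessel {ν : ℝ} (hν : -1 / 2 ≤ ν) :
    ContDiff ℝ ∞ fun x => (realBessel ν x : ℂ) :=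
  Complex.ofRealCLM.contDiff.comp (contDiff_realBessel hν)

/-- The derivative of j_ν is a constant times x j_(ν+1), so by Leibniz the n-th derivative involves
only derivatives n-1 and n-2 of j_(ν+1), with one factor x on the former. The induction therefore
runs over all orders ν at once, starting from the energy bound. -/
theorem norm_iteratedDeriv_realBessel_le {ν : ℝ} (hν : -1 / 2 ≤ ν) (n : ℕ) :
    ∃ C, 0 ≤ C ∧ ∀ x, ‖iteratedDeriv n (fun x => (realBessel ν x : ℂ)) x‖ ≤ C * (1 + |x|) ^ n := by
  induction n using Nat.strong_induction_on generalizing ν with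
  | _ n ih =>
  have hν' : -1 / 2 ≤ ν + 1 := by linarith
  have hdν : deriv (fun x => (realBessel ν x : ℂ)) = fun x =>
      (-1 / (2 * (ν + 1)) : ℝ) * (((x - 0 : ℝ) : ℂ) * (realBessel (ν + 1) x : ℂ)) := by
    funext x
    rw [((hasDerivAt_realBessel hν x).ofReal_comp).deriv]
    push_cast
    ring
  rcases n with _ | _ | m
  · refine ⟨1, zero_le_one, fun x => ?_⟩
    have := realBessel_sq_add_le_one hν x
    have : realBessel ν x ^ 2 ≤ 1 := by nlinarith [sq_nonneg (x * besselRatio ν x)]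
    simpa using this
  · obtain ⟨C, hC, h⟩ := ih 0 (by omega) hν'
    refine ⟨|-1 / (2 * (ν + 1))| * C, by positivity, fun x => ?_⟩
    have h := h x
    simp only [iteratedDeriv_zero, pow_zero, mul_one] at h
    rw [zero_add, iteratedDeriv_one, hdν, norm_mul, norm_mul, Complex.norm_real, Complex.norm_real,
      pow_one, mul_assoc, sub_zero, Real.norm_eq_abs, Real.norm_eq_abs, mul_comm C]
    gcongr
    linarith
  · obtain ⟨C₀, hC₀, h₀⟩ := ih (m + 1) (by omega) hν'
    obtain ⟨C₁, hC₁, h₁⟩ := ih m (by omega) hν'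
    refine ⟨|-1 / (2 * (ν + 1))| * (C₀ + (m + 1) * C₁), by positivity, fun x => ?_⟩
    have hx := abs_nonneg x
    rw [iteratedDeriv_succ', hdν, iteratedDeriv_const_mul_field,
      iteratedDeriv_sub_mul (contDiff_ofReal_realBessel hν'), norm_mul, Complex.norm_real,
      Real.norm_eq_abs, mul_assoc, add_mul C₀]
    gcongr
    refine (norm_add_le _ _).trans (add_le_add ?_ ?_)
    · rw [norm_mul, Complex.norm_real, sub_zero, Real.norm_eq_abs, pow_succ _ (m + 1), ← mul_assoc,
        mul_comm]
      gcongr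
      · exact h₀ x
      · linarith
    · rw [norm_mul, mul_assoc]
      have e : ‖((m : ℂ) + 1)‖ = m + 1 := by
        rw [show (m : ℂ) + 1 = ((m + 1 : ℝ) : ℂ) by push_cast; rfl, Complex.norm_real,
          Real.norm_of_nonneg (by positivity)]
      rw [e]
      gcongr
      refine (h₁ x).trans ?_
      gcongr
      · linarith
      · omega

theorem hasTemperateGrowth_realBessel {ν : ℝ} (hν : -1 / 2 ≤ ν) :
    (fun x => (realBessel ν x : ℂ)).HasTemperateGrowth := by
  refine ⟨contDiff_ofReal_realBessel hν, fun n => ?_⟩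
  obtain ⟨C, -, hC⟩ := norm_iteratedDeriv_realBessel_le hν n
  refine ⟨n, C, fun x => ?_⟩
  rw [norm_iteratedFDeriv_eq_norm_iteratedDeriv]
  exact hC x

/-- `dunklExp k x = E_k(-i, x)`. -/
noncomputable def dunklExp (k x : ℝ) : ℂ := realBessel k x - Complex.I * (x * besselRatio k x : ℝ)

theorem hasTemperateGrowth_besselRatio {k : ℝ} (hk : -1 / 2 ≤ k) :
    (fun x => (besselRatio k x : ℂ)).HasTemperateGrowth := by
  have h := (Function.HasTemperateGrowth.const (E := ℝ) ((1 / (2 * (k + 1)) : ℝ) : ℂ)).mul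
    (hasTemperateGrowth_realBessel (ν := k + 1) (by linarith))
  refine (congrArg Function.HasTemperateGrowth (funext fun x => ?_)).mp h
  simp [besselRatio, div_eq_inv_mul]

theorem hasTemperateGrowth_dunklExp {k : ℝ} (hk : -1 / 2 ≤ k) :
    (dunklExp k).HasTemperateGrowth := by
  have h := (hasTemperateGrowth_realBessel hk).sub
    ((Function.HasTemperateGrowth.const (E := ℝ) Complex.I).mul
      (Function.HasTemperateGrowth.mul Function.Complex.hasTemperateGrowth_ofReal (hasTemperateGrowth_besselRatio hk)))
  refine (congrArg Function.HasTemperateGrowth (funext fun x => ?_)).mp h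
  simp [dunklExp]

theorem norm_dunklExp_le_one {k : ℝ} (hk : -1 / 2 ≤ k) (x : ℝ) : ‖dunklExp k x‖ ≤ 1 := by
  have h := realBessel_sq_add_le_one hk x
  rw [← sq_le_one_iff₀ (norm_nonneg _), ← Complex.normSq_eq_norm_sq, Complex.normSq_apply]
  simp only [dunklExp, Complex.sub_re, Complex.sub_im, Complex.ofReal_re, Complex.ofReal_im,
    Complex.mul_re, Complex.mul_im, Complex.I_re, Complex.I_im]
  nlinarith

theorem dunklExp_neg (k x : ℝ) : dunklExp k (-x) = starRingEnd ℂ (dunklExp k x) := by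
  simp [dunklExp, realBessel_neg, besselRatio_neg]

theorem dunklExp_zero {k : ℝ} (hk : -1 / 2 ≤ k) : dunklExp k 0 = 1 := by
  simp [dunklExp, realBessel_zero hk]

/-- The differential equation of the Dunkl kernel. -/
theorem hasDerivAt_dunklExp {k : ℝ} (hk : -1 / 2 ≤ k) (x : ℝ) :
    HasDerivAt (dunklExp k)
      (-Complex.I * dunklExp k x + (2 * k + 1) * (Complex.I * besselRatio k x)) x := by
  have h1 := (hasDerivAt_realBessel' hk x).ofReal_comp
  have h2 := (((hasDerivAt_id x).mul (hasDerivAt_besselRatio hk x)).ofReal_comp).const_mul Complex.I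
  have h3 := congrArg (fun r : ℝ => (r : ℂ)) (mul_deriv_besselRatio hk x)
  push_cast at h3
  refine (h1.sub h2).congr_deriv ?_
  simp only [dunklExp, id]
  push_cast
  linear_combination (-Complex.I) * h3 + (-(x * besselRatio k x : ℂ)) * Complex.I_sq

/-- With a purely imaginary spectral parameter the Bessel argument i z x is real, so the real series
suffice. -/
theorem dunklKernel_eq_dunklExp (k b l x : ℝ) :
    dunklKernel k (-Complex.I * l / b) x = dunklExp k (l * x / b) := by
  have e : Complex.I * (-Complex.I * l / b * x) = ((l * x / b : ℝ) : ℂ) := by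
    push_cast
    linear_combination (-(l : ℂ) * x / b) * Complex.I_sq
  rw [dunklKernel, e, normalizedBessel_ofReal, normalizedBessel_ofReal, dunklExp, besselRatio]
  push_cast
  ring

/-! ### Smoothness of integrals depending on a parameter -/

theorem hasTemperateGrowth_deriv {h : ℝ → ℂ} (hh : h.HasTemperateGrowth) :
    (deriv h).HasTemperateGrowth := by
  refine ⟨(contDiff_infty_iff_deriv.1 hh.1).2, fun n => ?_⟩
  obtain ⟨k, C, hC⟩ := hh.2 (n + 1)
  refine ⟨k, C, fun x => ?_⟩
  have := hC x
  rw [norm_iteratedFDeriv_eq_norm_iteratedDeriv, iteratedDeriv_succ'] at this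
  rwa [norm_iteratedFDeriv_eq_norm_iteratedDeriv]

/-- `G` is integrable against all polynomials. -/
def HasMoments (ν : Measure ℝ) (G : ℝ → ℂ) : Prop :=
  AEStronglyMeasurable G ν ∧ ∀ m : ℕ, Integrable (fun x => (1 + |x|) ^ m * ‖G x‖) ν

theorem HasMoments.ofReal_mul {ν : Measure ℝ} {G : ℝ → ℂ} (hG : HasMoments ν G) :
    HasMoments ν fun x => (x : ℂ) * G x := by
  have hm : AEStronglyMeasurable (fun x : ℝ => (x : ℂ) * G x) ν :=
    Complex.continuous_ofReal.aestronglyMeasurable.mul hG.1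
  refine ⟨hm, fun m => (hG.2 (m + 1)).mono' ?_ (Eventually.of_forall fun x => ?_)⟩
  · exact (Continuous.aestronglyMeasurable (by fun_prop)).mul hm.norm
  · rw [norm_mul, norm_norm, norm_mul, Complex.norm_real, Real.norm_eq_abs, Real.norm_eq_abs,
      abs_of_nonneg (by positivity : 0 ≤ (1 + |x|) ^ m), pow_succ, mul_assoc]
    gcongr
    linarith

theorem HasMoments.integrable_mul {ν : Measure ℝ} {G h : ℝ → ℂ} (hG : HasMoments ν G)
    (hh : h.HasTemperateGrowth) (l : ℝ) : Integrable (fun x => G x * h (l * x)) ν := by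
  obtain ⟨k, C, hC⟩ := hh.2 0
  have hc : Continuous h := hh.1.continuous
  refine ((hG.2 k).const_mul (|C| * (1 + |l|) ^ k)).mono'
    (hG.1.mul (hc.comp (continuous_const.mul continuous_id)).aestronglyMeasurable)
    (Eventually.of_forall fun x => ?_)
  have h1 := hC (l * x)
  rw [norm_iteratedFDeriv_zero, Real.norm_eq_abs, abs_mul] at h1
  have h2 : (1 + |l| * |x|) ≤ (1 + |l|) * (1 + |x|) := by nlinarith [abs_nonneg l, abs_nonneg x]
  rw [norm_mul, mul_comm]
  calc ‖h (l * x)‖ * ‖G x‖ ≤ |C| * ((1 + |l|) * (1 + |x|)) ^ k * ‖G x‖ := by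
        gcongr
        refine h1.trans ?_
        gcongr
        exact le_abs_self C
    _ = _ := by rw [mul_pow]; ring

/-- For parameters in the unit ball around l, temperate growth of h' bounds the differentiated
integrand by a polynomial in |x| times |x G(x)|, and the moment condition makes this integrable. The
derivative has the same shape as the original integral, so smoothness follows by iteration. -/
theorem hasDerivAt_integral_mul_comp {ν : Measure ℝ} {G h : ℝ → ℂ} (hG : HasMoments ν G)
    (hh : h.HasTemperateGrowth) (l : ℝ) :
    HasDerivAt (fun l => ∫ x, G x * h (l * x) ∂ν) (∫ x : ℝ, ((x : ℂ) * G x) * deriv h (l * x) ∂ν) l := by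
  obtain ⟨k, C, hC⟩ := (hasTemperateGrowth_deriv hh).2 0
  have hc : Continuous h := hh.1.continuous
  refine (hasDerivAt_integral_of_dominated_loc_of_deriv_le (Metric.ball_mem_nhds l one_pos)
    (bound := fun x : ℝ => |C| * (|l| + 2) ^ k * ((1 + |x|) ^ k * ‖(x : ℂ) * G x‖))
    (F' := fun (l x : ℝ) => ((x : ℂ) * G x) * deriv h (l * x)) ?_ (hG.integrable_mul hh l) ?_ ?_ ?_ ?_).2
  · exact Eventually.of_forall fun m => (hG.integrable_mul hh m).1
  · exact (hG.ofReal_mul.integrable_mul (hasTemperateGrowth_deriv hh) l).1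
  · refine Eventually.of_forall fun x m hm => ?_
    have hm' : |m| ≤ |l| + 1 := by
      have h1 : |m - l| < 1 := by simpa [Real.dist_eq] using hm
      have h2 := abs_sub_abs_le_abs_sub m l
      linarith
    have h1 := hC (m * x)
    rw [norm_iteratedFDeriv_zero, Real.norm_eq_abs, abs_mul] at h1
    have h2 : (1 + |m| * |x|) ≤ (|l| + 2) * (1 + |x|) := by
      nlinarith [abs_nonneg l, abs_nonneg x, mul_le_mul_of_nonneg_right hm' (abs_nonneg x)]
    rw [norm_mul, mul_comm]
    calc ‖deriv h (m * x)‖ * ‖(x : ℂ) * G x‖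
        ≤ |C| * ((|l| + 2) * (1 + |x|)) ^ k * ‖(x : ℂ) * G x‖ := by
          gcongr
          refine h1.trans ?_
          gcongr
          exact le_abs_self C
      _ = _ := by rw [mul_pow]; ring
  · exact (hG.ofReal_mul.2 k).const_mul _
  · refine Eventually.of_forall fun x m _ => ?_
    have h1 : HasDerivAt h (deriv h (m * x)) (m * x) :=
      ((hh.1.differentiable (by simp)) _).hasDerivAt
    have h2 : HasDerivAt (fun m : ℝ => m * x) x m := by simpa using (hasDerivAt_id m).mul_const x
    refine ((h1.scomp m h2).const_mul (G x)).congr_deriv ?_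
    rw [Complex.real_smul]
    ring

theorem contDiff_integral_mul_comp {ν : Measure ℝ} {G h : ℝ → ℂ} (hG : HasMoments ν G)
    (hh : h.HasTemperateGrowth) : ContDiff ℝ ∞ fun l => ∫ x, G x * h (l * x) ∂ν := by
  rw [contDiff_infty]
  intro n
  induction n generalizing G h with
  | zero =>
    exact contDiff_zero.2 (continuous_iff_continuousAt.2 fun x =>
      (hasDerivAt_integral_mul_comp hG hh x).continuousAt)
  | succ n ih =>
    push_cast
    refine contDiff_succ_iff_deriv.2
      ⟨fun x => (hasDerivAt_integral_mul_comp hG hh x).differentiableAt, by simp, ?_⟩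
    rw [show deriv (fun l => ∫ x, G x * h (l * x) ∂ν) = _ from
      funext fun x => (hasDerivAt_integral_mul_comp hG hh x).deriv]
    exact ih hG.ofReal_mul (hasTemperateGrowth_deriv hh)

/-! ### Construction of Schwartz functions: division by x - a, even and odd parts -/

/-- On the compact ball |x - a| ≤ 1 continuity already bounds every seminorm, so decay has to be
checked only where division by x - a is harmless. -/
theorem exists_schwartzMap {f : ℝ → ℂ} (hf : ContDiff ℝ ∞ f) (a : ℝ)
    (h : ∀ p n : ℕ, ∃ C, ∀ x, 1 ≤ |x - a| → |x| ^ p * ‖iteratedDeriv n f x‖ ≤ C) :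
    ∃ φ : 𝓢(ℝ, ℂ), ∀ x, φ x = f x := by
  refine ⟨⟨f, hf, fun p n => ?_⟩, fun x => rfl⟩
  obtain ⟨C, hC⟩ := h p n
  have hc : Continuous fun x => |x| ^ p * ‖iteratedDeriv n f x‖ :=
    (continuous_abs.pow p).mul (hf.continuous_iteratedDeriv n (by exact_mod_cast le_top)).norm
  obtain ⟨C', hC'⟩ := (isCompact_closedBall a 1).exists_bound_of_continuousOn hc.continuousOn
  refine ⟨max C C', fun x => ?_⟩
  rw [norm_iteratedFDeriv_eq_norm_iteratedDeriv, Real.norm_eq_abs]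
  rcases le_total 1 |x - a| with hx | hx
  · exact (hC x hx).trans (le_max_left _ _)
  · exact ((le_abs_self _).trans (hC' x (by simpa [Real.dist_eq] using hx))).trans
      (le_max_right _ _)

/-- By Leibniz, (x-a)χ^(n+1) = φ^(n+1) - (n+1)χ^(n); for |x-a| ≥ 1 this bounds χ^(n+1) by quantities
whose decay is known inductively. -/
theorem exists_schwartzMap_of_sub_mul (φ : 𝓢(ℝ, ℂ)) {χ : ℝ → ℂ} (hχ : ContDiff ℝ ∞ χ) (a : ℝ)
    (h : ∀ x, φ x = ((x - a : ℝ) : ℂ) * χ x) : ∃ ψ : 𝓢(ℝ, ℂ), ∀ x, ψ x = χ x := by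
  refine exists_schwartzMap hχ a fun p n => ?_
  have hφ : ⇑φ = fun x => ((x - a : ℝ) : ℂ) * χ x := funext h
  have hd : ∀ n, ∃ C, ∀ x, |x| ^ p * ‖iteratedDeriv n φ x‖ ≤ C := fun n => by
    obtain ⟨C, hC⟩ := φ.decay p n
    refine ⟨C, fun x => ?_⟩
    have := hC.2 x
    rwa [norm_iteratedFDeriv_eq_norm_iteratedDeriv, Real.norm_eq_abs] at this
  have step : ∀ {x : ℝ} {z : ℂ}, 1 ≤ |x - a| → ‖z‖ ≤ ‖((x - a : ℝ) : ℂ) * z‖ := by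
    intro x z hx
    rw [norm_mul, Complex.norm_real, Real.norm_eq_abs]
    exact le_mul_of_one_le_left (norm_nonneg _) hx
  induction n with
  | zero =>
    obtain ⟨C, hC⟩ := hd 0
    refine ⟨C, fun x hx => (mul_le_mul_of_nonneg_left ?_ (by positivity)).trans (hC x)⟩
    rw [iteratedDeriv_zero, iteratedDeriv_zero, h]
    exact step hx
  | succ n ih =>
    obtain ⟨C₀, h₀⟩ := hd (n + 1)
    obtain ⟨C₁, h₁⟩ := ih
    refine ⟨C₀ + (n + 1) * C₁, fun x hx => ?_⟩
    have e : ((x - a : ℝ) : ℂ) * iteratedDeriv (n + 1) χ x =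
        iteratedDeriv (n + 1) φ x - (n + 1) * iteratedDeriv n χ x := by
      rw [hφ, iteratedDeriv_sub_mul hχ]
      ring
    have hn : ‖((n : ℂ) + 1)‖ = n + 1 := by
      rw [show (n : ℂ) + 1 = ((n + 1 : ℝ) : ℂ) by push_cast; rfl, Complex.norm_real,
        Real.norm_of_nonneg (by positivity)]
    have h2 : ‖iteratedDeriv (n + 1) χ x‖ ≤
        ‖iteratedDeriv (n + 1) φ x‖ + (n + 1) * ‖iteratedDeriv n χ x‖ := by
      refine (step hx).trans ?_
      rw [e, ← hn, ← norm_mul]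
      exact norm_sub_le _ _
    calc |x| ^ p * ‖iteratedDeriv (n + 1) χ x‖
        ≤ |x| ^ p * ‖iteratedDeriv (n + 1) φ x‖ + (n + 1) * (|x| ^ p * ‖iteratedDeriv n χ x‖) := by
          have := mul_le_mul_of_nonneg_left h2 (by positivity : 0 ≤ |x| ^ p)
          linarith
      _ ≤ _ := by
          gcongr
          · exact h₀ x
          · exact h₁ x hx

/-- Hadamard's lemma for Schwartz functions. -/
theorem exists_eq_sub_mul (φ : 𝓢(ℝ, ℂ)) {a : ℝ} (ha : φ a = 0) :
    ∃ χ : 𝓢(ℝ, ℂ), ∀ x, φ x = ((x - a : ℝ) : ℂ) * χ x := by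
  let φ' : 𝓢(ℝ, ℂ) := SchwartzMap.derivCLM ℂ ℂ φ
  have hφ' : ∀ x, φ' x = deriv φ x := fun x => rfl
  have hh : (fun y : ℝ => φ' (a + y)).HasTemperateGrowth := by
    have h1 : (fun y : ℝ => a + y).HasTemperateGrowth :=
      (Function.HasTemperateGrowth.const a).add Function.HasTemperateGrowth.id'
    exact φ'.hasTemperateGrowth.comp h1
  have hG : HasMoments (volume.restrict (Set.Icc (0 : ℝ) 1)) fun _ => 1 := by
    refine ⟨aestronglyMeasurable_const, fun m => ?_⟩
    exact (Continuous.continuousOn (by fun_prop)).integrableOn_Icc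
  have hsm := contDiff_integral_mul_comp hG hh
  -- The quotient is the average of φ' over the segment from a to x, which is smooth across a.
  let χ : ℝ → ℂ := fun x => ∫ t in Set.Icc (0 : ℝ) 1, 1 * φ' (a + (x - a) * t)
  have hχ : ContDiff ℝ ∞ χ := hsm.comp (contDiff_id.sub contDiff_const)
  have hfac : ∀ x, φ x = ((x - a : ℝ) : ℂ) * χ x := by
    intro x
    have hd : ∀ t : ℝ, HasDerivAt (fun t : ℝ => φ (a + (x - a) * t))
        (((x - a : ℝ) : ℂ) * (1 * φ' (a + (x - a) * t))) t := by
      intro t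
      have h1 : HasDerivAt (fun t : ℝ => a + (x - a) * t) (x - a) t := by
        simpa using ((hasDerivAt_id t).const_mul (x - a)).const_add a
      refine ((φ.hasDerivAt (a + (x - a) * t)).scomp t h1).congr_deriv ?_
      rw [Complex.real_smul, one_mul, hφ']
    have h2 := intervalIntegral.integral_eq_sub_of_hasDerivAt (a := 0) (b := 1)
      (fun t _ => hd t) (Continuous.intervalIntegrable (by fun_prop) _ _)
    rw [intervalIntegral.integral_of_le zero_le_one, ← integral_Icc_eq_integral_Ioc,
      integral_const_mul] at h2
    simp only [mul_one, add_sub_cancel, mul_zero, add_zero, ha, sub_zero] at h2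
    exact h2.symm
  obtain ⟨ψ, hψ⟩ := exists_schwartzMap_of_sub_mul φ hχ a hfac
  exact ⟨ψ, fun x => by rw [hψ, hfac]⟩

/-- Reflection of Schwartz functions. -/
noncomputable def reflect (φ : 𝓢(ℝ, ℂ)) : 𝓢(ℝ, ℂ) :=
  SchwartzMap.compCLMOfContinuousLinearEquiv ℂ (ContinuousLinearEquiv.neg ℝ) φ

theorem reflect_apply (φ : 𝓢(ℝ, ℂ)) (x : ℝ) : reflect φ x = φ (-x) := rfl

/-- Multiplication by the variable. -/
noncomputable def mulX (φ : 𝓢(ℝ, ℂ)) : 𝓢(ℝ, ℂ) :=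
  SchwartzMap.smulLeftCLM ℂ (fun x : ℝ => (x : ℂ)) φ

theorem mulX_apply (φ : 𝓢(ℝ, ℂ)) (x : ℝ) : mulX φ x = x * φ x :=
  SchwartzMap.smulLeftCLM_apply_apply Function.Complex.hasTemperateGrowth_ofReal φ x

/-- The derivative. -/
noncomputable def ddx (φ : 𝓢(ℝ, ℂ)) : 𝓢(ℝ, ℂ) := SchwartzMap.derivCLM ℂ ℂ φ

theorem hasDerivAt_ddx (φ : 𝓢(ℝ, ℂ)) (x : ℝ) : HasDerivAt φ (ddx φ x) x := φ.hasDerivAt x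

/-- In this form the Dunkl operator is p' + x q' + (2k+2) q: the difference quotient in its
definition has become the Schwartz function q, and no division by x remains. -/
theorem exists_even_add_mulX_even (φ : 𝓢(ℝ, ℂ)) :
    ∃ p q : 𝓢(ℝ, ℂ), (∀ x, p (-x) = p x) ∧ (∀ x, q (-x) = q x) ∧ ∀ x, φ x = p x + x * q x := by
  obtain ⟨q, hq⟩ := exists_eq_sub_mul ((1 / 2 : ℂ) • (φ - reflect φ)) (a := 0)
    (by simp [reflect_apply])
  have hq' : ∀ x, 1 / 2 * (φ x - φ (-x)) = x * q x := fun x => by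
    simpa [reflect_apply] using hq x
  refine ⟨(1 / 2 : ℂ) • (φ + reflect φ), q, fun x => ?_, fun x => ?_, fun x => ?_⟩
  · simp [reflect_apply, add_comm]
  · rcases eq_or_ne x 0 with rfl | hx
    · simp
    · have h1 := hq' x
      have h2 := hq' (-x)
      rw [neg_neg] at h2
      push_cast at h2
      have hx' : (x : ℂ) ≠ 0 := by exact_mod_cast hx
      apply mul_left_cancel₀ hx'
      linear_combination h2 + h1
  · rw [← hq' x]
    simp [reflect_apply]
    ring

/-! ### The Dunkl measure: integrability, the Euler operator, the Gaussian mass -/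

/-- The density of `dunklMeasure k`. -/
noncomputable def dunklWeight (k x : ℝ) : ℝ :=
  |x| ^ (2 * k + 1) / (2 ^ (k + 1) * Real.Gamma (k + 1))

theorem dunklMeasure_eq (k : ℝ) :
    dunklMeasure k = volume.withDensity fun x => ENNReal.ofReal (dunklWeight k x) := rfl

theorem dunklConst_pos {k : ℝ} (hk : -1 / 2 ≤ k) : 0 < 2 ^ (k + 1) * Real.Gamma (k + 1) := by
  have := Real.Gamma_pos_of_pos (s := k + 1) (by linarith)
  positivity

theorem dunklWeight_nonneg {k : ℝ} (hk : -1 / 2 ≤ k) (x : ℝ) : 0 ≤ dunklWeight k x :=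
  div_nonneg (by positivity) (dunklConst_pos hk).le

theorem continuous_dunklWeight {k : ℝ} (hk : -1 / 2 ≤ k) : Continuous (dunklWeight k) :=
  (continuous_abs.rpow_const fun _ => Or.inr (by linarith)).div_const _

theorem integral_dunklMeasure {k : ℝ} (hk : -1 / 2 ≤ k) (f : ℝ → ℂ) :
    ∫ x, f x ∂(dunklMeasure k) = ∫ x, (dunklWeight k x : ℂ) * f x := by
  rw [dunklMeasure_eq, integral_withDensity_eq_integral_toReal_smul
    (continuous_dunklWeight hk).measurable.ennreal_ofReal
    (Eventually.of_forall fun _ => ENNReal.ofReal_lt_top)]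
  simp only [ENNReal.toReal_ofReal (dunklWeight_nonneg hk _), Complex.real_smul]

theorem integrable_dunklMeasure {k : ℝ} (hk : -1 / 2 ≤ k) {f : ℝ → ℂ} :
    Integrable f (dunklMeasure k) ↔ Integrable fun x => (dunklWeight k x : ℂ) * f x := by
  rw [dunklMeasure_eq, integrable_withDensity_iff_integrable_smul'
    (continuous_dunklWeight hk).measurable.ennreal_ofReal
    (Eventually.of_forall fun _ => ENNReal.ofReal_lt_top)]
  simp only [ENNReal.toReal_ofReal (dunklWeight_nonneg hk _), Complex.real_smul]

theorem integrable_dunklMeasure_real {k : ℝ} (hk : -1 / 2 ≤ k) {f : ℝ → ℝ} :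
    Integrable f (dunklMeasure k) ↔ Integrable fun x => dunklWeight k x * f x := by
  rw [dunklMeasure_eq, integrable_withDensity_iff_integrable_smul'
    (continuous_dunklWeight hk).measurable.ennreal_ofReal
    (Eventually.of_forall fun _ => ENNReal.ofReal_lt_top)]
  simp only [ENNReal.toReal_ofReal (dunklWeight_nonneg hk _), smul_eq_mul]

/-- `(1 + |x|)^(-r)` is integrable for `r > 2k + 2`. -/
theorem integrable_one_add_abs_rpow {k : ℝ} (hk : -1 / 2 ≤ k) {r : ℝ} (hr : 2 * k + 2 < r) :
    Integrable (fun x : ℝ => (1 + |x|) ^ (-r)) (dunklMeasure k) := by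
  rw [integrable_dunklMeasure_real hk]
  have h := (integrable_one_add_norm (E := ℝ) (μ := volume) (r := r - (2 * k + 1))
    (by simp; linarith)).const_mul (1 / (2 ^ (k + 1) * Real.Gamma (k + 1)))
  have hpos := dunklConst_pos hk
  refine h.mono' ?_ (Eventually.of_forall fun x => ?_)
  · refine ((continuous_dunklWeight hk).mul ?_).aestronglyMeasurable
    exact (continuous_const.add continuous_abs).rpow_const
      fun x => Or.inl (by positivity : (0 : ℝ) < 1 + |x|).ne'
  · have h1 : (0 : ℝ) < 1 + |x| := by positivity
    rw [Real.norm_of_nonneg (mul_nonneg (dunklWeight_nonneg hk x) (by positivity)), dunklWeight,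
      show -(r - (2 * k + 1)) = (2 * k + 1) + -r by ring, Real.norm_eq_abs, Real.rpow_add h1,
      div_eq_inv_mul, one_div, mul_assoc]
    gcongr
    · linarith
    · linarith

/-- Temperate growth makes Schwartz functions integrable and square integrable for the measure. The
bound on k travels as a `Fact` so that instance search can use it. -/
instance [Fact (-1 / 2 ≤ (k : ℝ))] : (dunklMeasure k).HasTemperateGrowth where
  exists_integrable := by
    have hk : -1 / 2 ≤ k := Fact.out
    obtain ⟨n, hn⟩ := exists_nat_gt (2 * k + 2)
    exact ⟨n, integrable_one_add_abs_rpow hk hn⟩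

instance [Fact (-1 / 2 ≤ (k : ℝ))] : IsLocallyFiniteMeasure (dunklMeasure k) := by
  have hk : -1 / 2 ≤ k := Fact.out
  exact IsLocallyFiniteMeasure.withDensity_ofReal (continuous_dunklWeight hk)

/-- The formula persists at the origin, where the difference quotient is |t|^r. Hence x times the
density is differentiable everywhere, and integration by parts on the whole line has no contribution
from 0. -/
theorem hasDerivAt_mul_abs_rpow {r : ℝ} (hr : 0 ≤ r) (x : ℝ) :
    HasDerivAt (fun x : ℝ => x * |x| ^ r) ((r + 1) * |x| ^ r) x := by
  rcases hr.eq_or_lt with rfl | hr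
  · simpa using hasDerivAt_id' x
  rcases eq_or_ne x 0 with rfl | hx
  · rw [hasDerivAt_iff_tendsto_slope_zero]
    have hc : Tendsto (fun t : ℝ => |t| ^ r) (𝓝[≠] 0) (𝓝 ((r + 1) * |0| ^ r)) := by
      have : Continuous fun t : ℝ => |t| ^ r := continuous_abs.rpow_const fun _ => Or.inr hr.le
      have h := (this.tendsto 0).mono_left (nhdsWithin_le_nhds (s := {0}ᶜ))
      simpa [Real.zero_rpow hr.ne'] using h
    refine hc.congr' ?_
    filter_upwards [self_mem_nhdsWithin] with t ht
    have : t ≠ 0 := ht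
    simp [this]
  · have h1 := (hasDerivAt_abs hx).rpow_const (p := r) (Or.inl (abs_ne_zero.2 hx))
    refine ((hasDerivAt_id x).mul h1).congr_deriv ?_
    have h2 : |x| ^ r = |x| ^ (r - 1) * |x| := by
      rw [← Real.rpow_add_one (abs_ne_zero.2 hx), sub_add_cancel]
    have h3 : x * (SignType.sign x : ℝ) = |x| := self_mul_sign x
    simp only [id]
    rw [h2, ← h3]
    ring

section

variable {k : ℝ} [hk : Fact (-1 / 2 ≤ k)]

/-- The Euler operator integrates to zero against the Dunkl measure. -/
theorem integral_euler (F : 𝓢(ℝ, ℂ)) :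
    ∫ x, (x * ddx F x + (2 * k + 2) * F x) ∂(dunklMeasure k) = 0 := by
  have hk' := hk.out
  rw [integral_dunklMeasure hk']
  -- The density is homogeneous of degree 2k+1, so w(x)(xF' + (2k+2)F) is the exact derivative of x
  -- w(x) F.
  have hd : ∀ x, HasDerivAt (fun x : ℝ => ((x * dunklWeight k x : ℝ) : ℂ) * F x)
      ((dunklWeight k x : ℂ) * (x * ddx F x + (2 * k + 2) * F x)) x := by
    intro x
    have h1 : HasDerivAt (fun x : ℝ => x * dunklWeight k x) ((2 * k + 2) * dunklWeight k x) x := by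
      have := (hasDerivAt_mul_abs_rpow (r := 2 * k + 1) (by linarith) x).div_const
        (2 ^ (k + 1) * Real.Gamma (k + 1))
      simp only [dunklWeight, ← mul_div_assoc]
      exact this.congr_deriv (by ring)
    refine (h1.ofReal_comp.mul (hasDerivAt_ddx F x)).congr_deriv ?_
    push_cast
    ring
  refine integral_eq_zero_of_hasDerivAt_of_integrable hd ?_ ?_
  · have h := (integrable_dunklMeasure hk').1
      ((mulX (ddx F) + (2 * k + 2 : ℂ) • F).integrable (μ := dunklMeasure k))
    simpa [mulX_apply] using h
  · have h := (integrable_dunklMeasure hk').1 ((mulX F).integrable (μ := dunklMeasure k))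
    refine h.congr (Eventually.of_forall fun x => ?_)
    simp only [mulX_apply]
    push_cast
    ring

theorem integral_neg_dunklMeasure (f : ℝ → ℂ) :
    ∫ x, f (-x) ∂(dunklMeasure k) = ∫ x, f x ∂(dunklMeasure k) := by
  rw [integral_dunklMeasure hk.out, integral_dunklMeasure hk.out,
    ← integral_neg_eq_self (fun x => (dunklWeight k x : ℂ) * f x)]
  simp [dunklWeight]

theorem integral_odd_eq_zero {f : ℝ → ℂ} (hf : ∀ x, f (-x) = -f x) :
    ∫ x, f x ∂(dunklMeasure k) = 0 := by
  have h := integral_neg_dunklMeasure (k := k) f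
  simp only [hf, integral_neg] at h
  exact self_eq_neg.1 h.symm

/-- The normalizing constant of the measure enters here: it makes the Gaussian a fixed point of the
transform, not merely an eigenfunction. -/
theorem integral_gaussian_dunklMeasure :
    ∫ x : ℝ, (Real.exp (-x ^ 2 / 2) : ℂ) ∂(dunklMeasure k) = 1 := by
  have hk' := hk.out
  have hpos := dunklConst_pos hk'
  rw [integral_dunklMeasure hk']
  simp_rw [← Complex.ofReal_mul]
  rw [integral_complex_ofReal]
  have h1 : ∀ x : ℝ, dunklWeight k x * Real.exp (-x ^ 2 / 2) = (fun y : ℝ =>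
      (1 / (2 ^ (k + 1) * Real.Gamma (k + 1))) * (y ^ (2 * k + 1) *
        Real.exp (-(1 / 2) * y ^ (2 : ℝ)))) |x| := by
    intro x
    simp only [dunklWeight, Real.rpow_two, sq_abs]
    rw [show -(1 / 2 : ℝ) * x ^ 2 = -x ^ 2 / 2 by ring]
    ring
  simp_rw [h1]
  rw [integral_comp_abs (f := fun y : ℝ => (1 / (2 ^ (k + 1) * Real.Gamma (k + 1))) *
    (y ^ (2 * k + 1) * Real.exp (-(1 / 2) * y ^ (2 : ℝ)))), integral_const_mul,
    integral_rpow_mul_exp_neg_mul_rpow (by norm_num) (by linarith) (by norm_num)]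
  rw [show -(2 * k + 1 + 1) / 2 = -(k + 1) by ring, show (2 * k + 1 + 1) / 2 = k + 1 by ring,
    one_div (2 : ℝ), Real.inv_rpow (by norm_num), Real.rpow_neg (by norm_num), inv_inv]
  have := Real.Gamma_pos_of_pos (s := k + 1) (by linarith)
  norm_cast
  field_simp

theorem hasMoments_schwartz (φ : 𝓢(ℝ, ℂ)) : HasMoments (dunklMeasure k) φ := by
  refine ⟨φ.continuous.aestronglyMeasurable, fun m => ?_⟩
  have h1 : (fun x : ℝ => ((1 : ℂ) + (x : ℂ) ^ 2) ^ m).HasTemperateGrowth :=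
    (((Function.HasTemperateGrowth.const (1 : ℂ)).add
      (Function.Complex.hasTemperateGrowth_ofReal.pow 2)).pow m)
  have h2 := ((SchwartzMap.smulLeftCLM ℂ (fun x : ℝ => ((1 : ℂ) + (x : ℂ) ^ 2) ^ m) φ).integrable
    (μ := dunklMeasure k)).norm.const_mul (2 ^ m)
  refine h2.mono' (Continuous.aestronglyMeasurable (by fun_prop)) (Eventually.of_forall fun x => ?_)
  rw [SchwartzMap.smulLeftCLM_apply_apply h1, smul_eq_mul, norm_mul, norm_mul, norm_norm, norm_pow,
    norm_pow, ← mul_assoc, ← mul_pow, Real.norm_of_nonneg (by positivity),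
    show (1 : ℂ) + (x : ℂ) ^ 2 = ((1 + x ^ 2 : ℝ) : ℂ) by push_cast; rfl, Complex.norm_real,
    Real.norm_of_nonneg (by positivity)]
  gcongr
  nlinarith [sq_abs x, sq_nonneg (|x| - 1)]

end

/-! ### The Dunkl transform on the Schwartz space -/

theorem hasTemperateGrowth_comp_mul {h : ℝ → ℂ} (hh : h.HasTemperateGrowth) (l : ℝ) :
    (fun x => h (l * x)).HasTemperateGrowth :=
  hh.comp ((Function.HasTemperateGrowth.const l).mul Function.HasTemperateGrowth.id')

/-- The Dunkl transform `∫ φ(x) E_k(-i l, x) dμ_k(x)`. -/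
noncomputable def dunklTransform (k : ℝ) (φ : ℝ → ℂ) (l : ℝ) : ℂ :=
  ∫ x, φ x * dunklExp k (l * x) ∂(dunklMeasure k)

theorem dunklTransform_smul (k : ℝ) (c : ℂ) (φ : 𝓢(ℝ, ℂ)) (l : ℝ) :
    dunklTransform k (c • φ : 𝓢(ℝ, ℂ)) l = c * dunklTransform k φ l := by
  simp only [dunklTransform, smul_apply, smul_eq_mul, mul_assoc]
  exact integral_const_mul _ _

section

variable {k : ℝ} [hk : Fact (-1 / 2 ≤ k)]

/-- Schwartz function times a dilated function of temperate growth. -/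
theorem exists_schwartz_mul_comp (φ : 𝓢(ℝ, ℂ)) {h : ℝ → ℂ} (hh : h.HasTemperateGrowth) (l : ℝ) :
    ∃ F : 𝓢(ℝ, ℂ), (∀ x, F x = φ x * h (l * x)) ∧
      ∀ x, ddx F x = ddx φ x * h (l * x) + φ x * (l * deriv h (l * x)) := by
  have hF : ∀ x, SchwartzMap.smulLeftCLM ℂ (fun x => h (l * x)) φ x = φ x * h (l * x) := fun x => by
    rw [SchwartzMap.smulLeftCLM_apply_apply (hasTemperateGrowth_comp_mul hh l), smul_eq_mul,
      mul_comm]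
  refine ⟨SchwartzMap.smulLeftCLM ℂ (fun x => h (l * x)) φ, hF, fun x => ?_⟩
  refine (hasDerivAt_ddx _ x).unique ?_
  rw [show ⇑(SchwartzMap.smulLeftCLM ℂ (fun x => h (l * x)) φ) = _ from funext hF]
  have h1 : HasDerivAt h (deriv h (l * x)) (l * x) :=
    ((hh.1.differentiable (by simp)) _).hasDerivAt
  have h2 : HasDerivAt (fun x : ℝ => l * x) l x := by simpa using (hasDerivAt_id x).const_mul l
  refine ((hasDerivAt_ddx φ x).mul (h1.scomp x h2)).congr_deriv ?_
  simp [Complex.real_smul]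

theorem integrable_schwartz_mul (φ : 𝓢(ℝ, ℂ)) {h : ℝ → ℂ} (hh : h.HasTemperateGrowth) (l : ℝ) :
    Integrable (fun x => φ x * h (l * x)) (dunklMeasure k) :=
  (hasMoments_schwartz φ).integrable_mul hh l

/-- Integration by parts for the Euler operator. -/
theorem integral_euler_mul (φ : 𝓢(ℝ, ℂ)) {h : ℝ → ℂ} (hh : h.HasTemperateGrowth) (l : ℝ) :
    ∫ x, (x * ddx φ x + (2 * k + 2) * φ x) * h (l * x) ∂(dunklMeasure k) =
      -∫ x : ℝ, φ x * ((l * x : ℝ) * deriv h (l * x)) ∂(dunklMeasure k) := by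
  obtain ⟨F, hF, hF'⟩ := exists_schwartz_mul_comp φ hh l
  have h0 := integral_euler (k := k) F
  have i1 := integrable_schwartz_mul (k := k) (mulX (ddx φ) + (2 * k + 2 : ℂ) • φ) hh l
  have i2 := (integrable_schwartz_mul (k := k) (mulX φ) (hasTemperateGrowth_deriv hh) l).const_mul
    (l : ℂ)
  simp only [add_apply, smul_apply, mulX_apply, smul_eq_mul] at i1 i2
  rw [eq_neg_iff_add_eq_zero, ← h0, ← integral_add i1]
  · refine integral_congr_ae (Eventually.of_forall fun x => ?_)
    simp only [hF, hF']
    push_cast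
    ring
  · refine i2.congr (Eventually.of_forall fun x => ?_)
    push_cast
    ring

theorem norm_dunklTransform_le (φ : 𝓢(ℝ, ℂ)) (l : ℝ) :
    ‖dunklTransform k φ l‖ ≤ ∫ x, ‖φ x‖ ∂(dunklMeasure k) := by
  refine norm_integral_le_of_norm_le φ.integrable.norm (Eventually.of_forall fun x => ?_)
  rw [norm_mul]
  exact mul_le_of_le_one_right (norm_nonneg _) (norm_dunklExp_le_one hk.out _)

theorem contDiff_dunklTransform (φ : 𝓢(ℝ, ℂ)) : ContDiff ℝ ∞ (dunklTransform k φ) :=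
  contDiff_integral_mul_comp (hasMoments_schwartz φ) (hasTemperateGrowth_dunklExp hk.out)

theorem hasDerivAt_dunklTransform (φ : 𝓢(ℝ, ℂ)) (l : ℝ) :
    HasDerivAt (dunklTransform k φ)
      (∫ x : ℝ, ((x : ℂ) * φ x) * deriv (dunklExp k) (l * x) ∂(dunklMeasure k)) l :=
  hasDerivAt_integral_mul_comp (hasMoments_schwartz φ) (hasTemperateGrowth_dunklExp hk.out) l

theorem dunklTransform_add (φ ψ : 𝓢(ℝ, ℂ)) (l : ℝ) :
    dunklTransform k (φ + ψ : 𝓢(ℝ, ℂ)) l = dunklTransform k φ l + dunklTransform k ψ l := by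
  simp only [dunklTransform, add_apply, add_mul]
  exact integral_add (integrable_schwartz_mul φ (hasTemperateGrowth_dunklExp hk.out) l)
    (integrable_schwartz_mul ψ (hasTemperateGrowth_dunklExp hk.out) l)

/-- On functions of the product l x the operators l d/dl and x d/dx agree, and integration by parts
moves the latter onto φ. -/
theorem mul_deriv_dunklTransform (φ : 𝓢(ℝ, ℂ)) (l : ℝ) :
    l * deriv (dunklTransform k φ) l =
      dunklTransform k (-(mulX (ddx φ) + (2 * k + 2 : ℂ) • φ) : 𝓢(ℝ, ℂ)) l := by
  have h := integral_euler_mul (k := k) φ (hasTemperateGrowth_dunklExp hk.out) l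
  rw [(hasDerivAt_dunklTransform φ l).deriv, ← integral_const_mul]
  simp only [dunklTransform, neg_apply, add_apply, smul_apply,
    smul_eq_mul, mulX_apply, neg_mul]
  rw [integral_neg, h, neg_neg]
  refine integral_congr_ae (Eventually.of_forall fun x => ?_)
  push_cast
  ring

theorem exists_pow_mul_iteratedDeriv_dunklTransform (n : ℕ) (φ : 𝓢(ℝ, ℂ)) :
    ∃ ψ : 𝓢(ℝ, ℂ), ∀ l : ℝ, (l : ℂ) ^ n * iteratedDeriv n (dunklTransform k φ) l =
      dunklTransform k ψ l := by
  induction n with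
  | zero => exact ⟨φ, fun l => by simp⟩
  | succ n ih =>
    obtain ⟨ψ, hψ⟩ := ih
    -- From l (l^n f^(n))' - n l^n f^(n) = l^(n+1) f^(n+1).
    refine ⟨-(mulX (ddx ψ) + (2 * k + 2 : ℂ) • ψ) + (-n : ℂ) • ψ, fun l => ?_⟩
    rw [dunklTransform_add, dunklTransform_smul, ← mul_deriv_dunklTransform, ← hψ,
      ← show _ = dunklTransform k ψ from funext hψ]
    have hd : HasDerivAt (iteratedDeriv n (dunklTransform k φ))
        (iteratedDeriv (n + 1) (dunklTransform k φ) l) l := by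
      rw [iteratedDeriv_succ]
      exact (((contDiff_dunklTransform φ).differentiable_iteratedDeriv n
        (by exact_mod_cast WithTop.coe_lt_top _)) l).hasDerivAt
    have hp : HasDerivAt (fun l : ℝ => (l : ℂ) ^ n) (n * (l : ℂ) ^ (n - 1)) l := by
      refine (((hasDerivAt_id l).ofReal_comp).pow n).congr_deriv ?_
      simp
    rw [show deriv (fun x : ℝ => (x : ℂ) ^ n * iteratedDeriv n (dunklTransform k φ) x) l = _ from
      (hp.mul hd).deriv]
    rcases n with _ | n
    · simp
    · simp only [Nat.add_sub_cancel]
      push_cast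
      ring

theorem ddx_neg_of_even {p : 𝓢(ℝ, ℂ)} (hp : ∀ x, p (-x) = p x) (x : ℝ) :
    ddx p (-x) = -ddx p x := by
  have h := (hasDerivAt_ddx p (-x)).scomp x (hasDerivAt_neg x)
  rw [show ⇑p ∘ Neg.neg = p from funext hp] at h
  rw [(hasDerivAt_ddx p x).unique h]
  simp

/-- The Dunkl transform of a sum of an even and an odd function. -/
theorem dunklTransform_even_add_odd {A B : 𝓢(ℝ, ℂ)} (hA : ∀ x, A (-x) = A x)
    (hB : ∀ x, B (-x) = -B x) (l : ℝ) :
    dunklTransform k (A + B : 𝓢(ℝ, ℂ)) l =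
      ∫ x, A x * (realBessel k (l * x) : ℂ) ∂(dunklMeasure k) -
        Complex.I * l * ∫ x : ℝ, x * B x * (besselRatio k (l * x) : ℂ) ∂(dunklMeasure k) := by
  have hJ := hasTemperateGrowth_realBessel hk.out
  have hv := hasTemperateGrowth_besselRatio hk.out
  have i1 := integrable_schwartz_mul (k := k) A hJ l
  have i2 := (integrable_schwartz_mul (k := k) (mulX B) hv l).const_mul (Complex.I * l)
  have i3 := integrable_schwartz_mul (k := k) B hJ l
  have i4 := (integrable_schwartz_mul (k := k) (mulX A) hv l).const_mul (Complex.I * l)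
  simp only [mulX_apply] at i2 i4
  have hodd : ∫ x : ℝ, (B x * (realBessel k (l * x) : ℂ) -
      Complex.I * l * (x * A x * (besselRatio k (l * x) : ℂ))) ∂(dunklMeasure k) = 0 := by
    refine integral_odd_eq_zero fun x => ?_
    rw [hA, hB, mul_neg, realBessel_neg, besselRatio_neg]
    push_cast
    ring
  rw [← integral_const_mul, ← integral_sub i1 i2, ← add_zero (∫ x, _ ∂_), ← hodd]
  refine Eq.trans ?_ (integral_add (i1.sub i2) (i3.sub i4))
  refine integral_congr_ae (Eventually.of_forall fun x => ?_)
  simp only [add_apply, dunklExp]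
  push_cast
  ring

/-- The Dunkl operator turns into multiplication by `i l`. -/
theorem dunklTransform_dunklOperator {φ p q : 𝓢(ℝ, ℂ)} (hp : ∀ x, p (-x) = p x)
    (hq : ∀ x, q (-x) = q x) (hφ : ∀ x, φ x = p x + x * q x) (l : ℝ) :
    dunklTransform k (ddx p + (mulX (ddx q) + (2 * k + 2 : ℂ) • q) : 𝓢(ℝ, ℂ)) l =
      Complex.I * l * dunklTransform k φ l := by
  have hJ := hasTemperateGrowth_realBessel hk.out
  have hv := hasTemperateGrowth_besselRatio hk.out
  have hφ' : φ = p + mulX q := by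
    ext x
    rw [hφ, add_apply, mulX_apply]
  rw [add_comm (ddx p), dunklTransform_even_add_odd (fun x => ?_) (ddx_neg_of_even hp), hφ',
    dunklTransform_even_add_odd hp (fun x => ?_)]
  rotate_left
  · simp only [mulX_apply, hq]
    push_cast
    ring
  · simp only [add_apply, smul_apply, mulX_apply, ddx_neg_of_even hq, hq]
    push_cast
    ring
  -- The odd component x q contributes through j_k and the even component p through `besselRatio`;
  -- each is integrated by parts once, using j_k' = -y v and y v' = j_k - (2k+2) v with v =
  -- `besselRatio k`.
  have e1 := integral_euler_mul (k := k) q hJ l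
  have e2 := integral_euler_mul (k := k) p hv l
  have d1 : ∀ y, deriv (fun x => (realBessel k x : ℂ)) y = -(y * besselRatio k y : ℝ) := fun y => by
    rw [((hasDerivAt_realBessel' hk.out y).ofReal_comp).deriv]
    push_cast
    ring
  have d2 : ∀ y : ℝ, (y : ℂ) * deriv (fun x => (besselRatio k x : ℂ)) y =
      realBessel k y - (2 * k + 2) * besselRatio k y := fun y => by
    rw [((hasDerivAt_besselRatio hk.out y).ofReal_comp).deriv, ← Complex.ofReal_mul,
      mul_deriv_besselRatio hk.out]
    push_cast
    ring
  have i1 := integrable_schwartz_mul (k := k) p hJ l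
  have i2 := (integrable_schwartz_mul (k := k) p hv l).const_mul (2 * k + 2 : ℂ)
  have i3 := integrable_schwartz_mul (k := k) (mulX (ddx p)) hv l
  simp only [mulX_apply] at i3
  have e2' : ∫ x : ℝ, x * ddx p x * (besselRatio k (l * x) : ℂ) ∂(dunklMeasure k) =
      -∫ x, p x * (realBessel k (l * x) : ℂ) ∂(dunklMeasure k) := by
    have a1 : ∫ x : ℝ, p x * ((l * x : ℝ) * deriv (fun x => (besselRatio k x : ℂ)) (l * x))
        ∂(dunklMeasure k) = ∫ x, p x * (realBessel k (l * x) : ℂ) ∂(dunklMeasure k) -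
          ∫ x, (2 * k + 2 : ℂ) * (p x * (besselRatio k (l * x) : ℂ)) ∂(dunklMeasure k) := by
      rw [← integral_sub i1 i2]
      refine integral_congr_ae (Eventually.of_forall fun x => ?_)
      simp only [d2]
      ring
    have a2 : ∫ x : ℝ, (x * ddx p x + (2 * k + 2) * p x) * (besselRatio k (l * x) : ℂ)
        ∂(dunklMeasure k) = ∫ x : ℝ, x * ddx p x * (besselRatio k (l * x) : ℂ) ∂(dunklMeasure k) +
          ∫ x, (2 * k + 2 : ℂ) * (p x * (besselRatio k (l * x) : ℂ)) ∂(dunklMeasure k) := by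
      rw [← integral_add i3 i2]
      refine integral_congr_ae (Eventually.of_forall fun x => ?_)
      ring
    rw [a1, a2] at e2
    linear_combination e2
  have e1' : ∫ x : ℝ, (mulX (ddx q) + (2 * k + 2 : ℂ) • q : 𝓢(ℝ, ℂ)) x * (realBessel k (l * x) : ℂ)
      ∂(dunklMeasure k) =
      (l : ℂ) ^ 2 * ∫ x : ℝ, x * (mulX q) x * (besselRatio k (l * x) : ℂ) ∂(dunklMeasure k) := by
    simp only [add_apply, smul_apply, mulX_apply, smul_eq_mul]
    rw [e1, ← integral_neg, ← integral_const_mul]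
    refine integral_congr_ae (Eventually.of_forall fun x => ?_)
    simp only [d1]
    push_cast
    ring
  rw [e1', e2']
  generalize (∫ x : ℝ, (x : ℂ) * (mulX q) x * (besselRatio k (l * x) : ℂ) ∂(dunklMeasure k)) = U
  linear_combination ((l : ℂ) ^ 2 * U) * Complex.I_sq

theorem exists_mul_dunklTransform (φ : 𝓢(ℝ, ℂ)) :
    ∃ ψ : 𝓢(ℝ, ℂ), ∀ l : ℝ, dunklTransform k ψ l = l * dunklTransform k φ l := by
  obtain ⟨p, q, hp, hq, hφ⟩ := exists_even_add_mulX_even φ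
  refine ⟨(-Complex.I) • (ddx p + (mulX (ddx q) + (2 * k + 2 : ℂ) • q)), fun l => ?_⟩
  rw [dunklTransform_smul, dunklTransform_dunklOperator hp hq hφ]
  linear_combination (-(l : ℂ) * dunklTransform k φ l) * Complex.I_sq

theorem exists_pow_mul_dunklTransform (n : ℕ) (φ : 𝓢(ℝ, ℂ)) :
    ∃ ψ : 𝓢(ℝ, ℂ), ∀ l : ℝ, dunklTransform k ψ l = l ^ n * dunklTransform k φ l := by
  induction n with
  | zero => exact ⟨φ, fun l => by simp⟩
  | succ n ih =>
    obtain ⟨ψ, hψ⟩ := ih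
    obtain ⟨χ, hχ⟩ := exists_mul_dunklTransform (k := k) ψ
    exact ⟨χ, fun l => by rw [hχ, hψ]; ring⟩

/-- The product l^(p+n) times the n-th derivative is again the transform of a Schwartz function,
hence bounded. The surplus factor l^n only helps when |l| ≥ 1, and nothing more has to be checked.
-/
theorem exists_schwartz_dunklTransform (φ : 𝓢(ℝ, ℂ)) :
    ∃ ψ : 𝓢(ℝ, ℂ), ∀ l, ψ l = dunklTransform k φ l := by
  refine exists_schwartzMap (contDiff_dunklTransform φ) 0 fun p n => ?_
  obtain ⟨ψ, hψ⟩ := exists_pow_mul_iteratedDeriv_dunklTransform (k := k) n φ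
  obtain ⟨χ, hχ⟩ := exists_pow_mul_dunklTransform (k := k) p ψ
  refine ⟨∫ x, ‖χ x‖ ∂(dunklMeasure k), fun l hl => ?_⟩
  refine le_trans ?_ (norm_dunklTransform_le χ l)
  rw [sub_zero] at hl
  rw [hχ, ← hψ, norm_mul, norm_mul, norm_pow, norm_pow, Complex.norm_real, Real.norm_eq_abs]
  gcongr
  exact le_mul_of_one_le_left (norm_nonneg _) (one_le_pow₀ hl)

end

/-! ### The Gaussian, chirps and the inversion formula -/

theorem abs_pow_mul_exp_le (p : ℕ) (x : ℝ) :
    |x| ^ p * Real.exp (-x ^ 2 / 2) ≤ 1 + 2 ^ p * p.factorial := by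
  have h1 := Real.pow_div_factorial_le_exp (x ^ 2 / 2) (by positivity) p
  have h2 : |x| ^ p ≤ 1 + (x ^ 2) ^ p := by
    rw [← sq_abs, ← pow_mul, mul_comm, pow_mul]
    nlinarith [sq_nonneg (|x| ^ p - 1), sq_nonneg (|x| ^ p)]
  have h3 : (x ^ 2) ^ p ≤ 2 ^ p * p.factorial * Real.exp (x ^ 2 / 2) := by
    rw [div_pow, div_div, div_le_iff₀ (by positivity)] at h1
    linarith
  have h4 : Real.exp (-x ^ 2 / 2) * Real.exp (x ^ 2 / 2) = 1 := by
    rw [← Real.exp_add]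
    simp [neg_div]
  have h5 : Real.exp (-x ^ 2 / 2) ≤ 1 := Real.exp_le_one_iff.2 (by nlinarith [sq_nonneg x])
  calc |x| ^ p * Real.exp (-x ^ 2 / 2)
      ≤ (1 + 2 ^ p * p.factorial * Real.exp (x ^ 2 / 2)) * Real.exp (-x ^ 2 / 2) := by
        gcongr
        linarith
    _ = Real.exp (-x ^ 2 / 2) + 2 ^ p * p.factorial := by
        linear_combination (2 ^ p * p.factorial : ℝ) * h4
    _ ≤ _ := by linarith

/-- The Gaussian `exp(-x²/2)` as a Schwartz function. -/
theorem exists_gaussian : ∃ G : 𝓢(ℝ, ℂ), ∀ x, G x = (Real.exp (-x ^ 2 / 2) : ℂ) := by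
  let f : ℝ → ℂ := fun x => (Real.exp (-x ^ 2 / 2) : ℂ)
  have hf : ContDiff ℝ ∞ f := Complex.ofRealCLM.contDiff.comp
    (Real.contDiff_exp.comp (by fun_prop : ContDiff ℝ ∞ fun x : ℝ => -x ^ 2 / 2))
  have hd : deriv f = fun x => -(((x - 0 : ℝ) : ℂ) * f x) := by
    funext x
    have h1 : HasDerivAt (fun x : ℝ => -x ^ 2 / 2) (-x) x := by
      refine (((hasDerivAt_pow 2 x).fun_neg).div_const 2).congr_deriv ?_
      push_cast
      ring
    refine (h1.exp.ofReal_comp).deriv.trans ?_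
    simp only [f]
    push_cast
    ring
  have h0 : ∀ p : ℕ, ∃ C, ∀ x, |x| ^ p * ‖f x‖ ≤ C := fun p =>
    ⟨_, fun x => by
      rw [Complex.norm_real, Real.norm_of_nonneg (Real.exp_pos _).le]
      exact abs_pow_mul_exp_le p x⟩
  refine exists_schwartzMap hf 0 fun p n => ?_
  suffices h : ∃ C, ∀ x, |x| ^ p * ‖iteratedDeriv n f x‖ ≤ C from h.imp fun C hC x _ => hC x
  induction n using Nat.strong_induction_on generalizing p with
  | _ n ih =>
  rcases n with _ | _ | n
  · simpa using h0 p
  · obtain ⟨C, hC⟩ := h0 (p + 1)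
    refine ⟨C, fun x => ?_⟩
    rw [zero_add, iteratedDeriv_one, hd, norm_neg, norm_mul, sub_zero, Complex.norm_real,
      Real.norm_eq_abs, ← mul_assoc, ← pow_succ]
    exact hC x
  · obtain ⟨C₀, h₀⟩ := ih (n + 1) (by omega) (p + 1)
    obtain ⟨C₁, h₁⟩ := ih n (by omega) p
    refine ⟨C₀ + (n + 1) * C₁, fun x => ?_⟩
    have hn : ‖((n : ℂ) + 1)‖ = n + 1 := by
      rw [show (n : ℂ) + 1 = ((n + 1 : ℝ) : ℂ) by push_cast; rfl, Complex.norm_real,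
        Real.norm_of_nonneg (by positivity)]
    rw [iteratedDeriv_succ', hd, iteratedDeriv_fun_neg, iteratedDeriv_sub_mul hf, norm_neg, sub_zero]
    have e := norm_add_le ((x : ℂ) * iteratedDeriv (n + 1) f x) ((n + 1) * iteratedDeriv n f x)
    rw [norm_mul, norm_mul, hn, Complex.norm_real, Real.norm_eq_abs] at e
    have e' := mul_le_mul_of_nonneg_left e (by positivity : 0 ≤ |x| ^ p)
    have e₀ := h₀ x
    have e₁ := mul_le_mul_of_nonneg_left (h₁ x) (by positivity : (0 : ℝ) ≤ n + 1)
    rw [pow_succ] at e₀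
    linarith

theorem hasTemperateGrowth_cexp_I_mul : (fun y : ℝ => Complex.exp (Complex.I * y)).HasTemperateGrowth := by
  have hd : ∀ n : ℕ, iteratedDeriv n (fun y : ℝ => Complex.exp (Complex.I * y)) =
      fun y : ℝ => Complex.I ^ n * Complex.exp (Complex.I * y) := by
    intro n
    induction n with
    | zero => simp
    | succ n ih =>
      rw [iteratedDeriv_succ, ih]
      funext y
      have h := ((((hasDerivAt_id y).ofReal_comp).const_mul Complex.I).cexp).const_mul
        (Complex.I ^ n)
      refine h.deriv.trans ?_
      simp only [id, Complex.ofReal_one, mul_one]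
      ring
  refine ⟨Complex.contDiff_exp.comp (contDiff_const.mul Complex.ofRealCLM.contDiff), fun n =>
    ⟨0, 1, fun x => ?_⟩⟩
  rw [norm_iteratedFDeriv_eq_norm_iteratedDeriv, hd, norm_mul, norm_pow, Complex.norm_I,
    mul_comm Complex.I, Complex.norm_exp_ofReal_mul_I]
  simp

/-- The chirp `exp(i c x² / 2)`. -/
theorem hasTemperateGrowth_chirp (c : ℝ) :
    (fun x : ℝ => Complex.exp (Complex.I / 2 * ((c * x ^ 2 : ℝ) : ℂ))).HasTemperateGrowth := by
  have h1 : (fun x : ℝ => c / 2 * x ^ 2).HasTemperateGrowth :=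
    (Function.HasTemperateGrowth.const (c / 2)).mul (Function.HasTemperateGrowth.id'.pow 2)
  refine (congrArg Function.HasTemperateGrowth (funext fun x => ?_)).mp
    (hasTemperateGrowth_cexp_I_mul.comp h1)
  simp only [Function.comp]
  push_cast
  ring_nf

section

variable {k : ℝ} [hk : Fact (-1 / 2 ≤ k)]

/-- Multiplication by the variable turns into `i` times the Dunkl operator. -/
theorem dunklTransform_mulX {φ f p q : 𝓢(ℝ, ℂ)} (hf : ∀ l, f l = dunklTransform k φ l)
    (hp : ∀ x, p (-x) = p x) (hq : ∀ x, q (-x) = q x) (hpq : ∀ x, f x = p x + x * q x) (l : ℝ) :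
    dunklTransform k (mulX φ) l =
      Complex.I * (ddx p + (mulX (ddx q) + (2 * k + 2 : ℂ) • q) : 𝓢(ℝ, ℂ)) l := by
  have he := hasTemperateGrowth_dunklExp hk.out
  have hv := hasTemperateGrowth_besselRatio hk.out
  suffices h : dunklTransform k (mulX φ) = fun l : ℝ =>
      Complex.I * (ddx p + (mulX (ddx q) + (2 * k + 2 : ℂ) • q) : 𝓢(ℝ, ℂ)) l from congrFun h l
  -- The odd part of f determines l q(l), hence q only off l = 0; continuity supplies the missing
  -- point.
  refine Continuous.ext_on (dense_compl_singleton (0 : ℝ))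
    (contDiff_dunklTransform (mulX φ)).continuous (by fun_prop) fun l hl => ?_
  have hl' : (l : ℂ) ≠ 0 := by exact_mod_cast hl
  have i1 := integrable_schwartz_mul (k := k) φ he l
  have i2 := integrable_schwartz_mul (k := k) φ he (-l)
  have i3 := integrable_schwartz_mul (k := k) (mulX φ) he l
  have i4 := integrable_schwartz_mul (k := k) (mulX φ) hv l
  have hfp : ddx f l = ddx p l + (q l + l * ddx q l) := by
    have h1 : HasDerivAt (fun x : ℝ => p x + (x : ℂ) * q x) (ddx p l + (1 * q l + l * ddx q l)) l := by
      have := (hasDerivAt_id l).ofReal_comp.mul (hasDerivAt_ddx q l)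
      exact (hasDerivAt_ddx p l).add (this.congr_deriv (by simp))
    rw [← show ⇑f = _ from funext hpq] at h1
    rw [(hasDerivAt_ddx f l).unique h1, one_mul]
  have hfd : ddx f l = -Complex.I * dunklTransform k (mulX φ) l + (2 * k + 1) * (Complex.I *
      ∫ x, (mulX φ) x * (besselRatio k (l * x) : ℂ) ∂(dunklMeasure k)) := by
    have h1 := hasDerivAt_dunklTransform (k := k) φ l
    rw [← show ⇑f = _ from funext hf] at h1
    rw [(hasDerivAt_ddx f l).unique h1, dunklTransform, ← integral_const_mul, ← integral_const_mul,
      ← integral_const_mul, ← integral_add (i3.const_mul _) ((i4.const_mul _).const_mul _)]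
    refine integral_congr_ae (Eventually.of_forall fun x => ?_)
    simp only [(hasDerivAt_dunklExp hk.out _).deriv, mulX_apply]
    ring
  have hql : q l = -Complex.I * ∫ x, (mulX φ) x * (besselRatio k (l * x) : ℂ) ∂(dunklMeasure k) := by
    have h1 : f l - f (-l) = 2 * (l * q l) := by
      rw [hpq l, hpq (-l), hp, hq]
      push_cast
      ring
    apply mul_left_cancel₀ (mul_ne_zero two_ne_zero hl')
    rw [mul_assoc, ← h1, hf, hf, dunklTransform, dunklTransform, ← integral_sub i1 i2,
      ← integral_const_mul, ← integral_const_mul]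
    refine integral_congr_ae (Eventually.of_forall fun x => ?_)
    simp only [mulX_apply, neg_mul, dunklExp, realBessel_neg, besselRatio_neg]
    push_cast
    ring
  simp only [add_apply, smul_apply, mulX_apply, smul_eq_mul]
  have h2 : ddx p l = ddx f l - (q l + l * ddx q l) := by rw [hfp]; ring
  rw [h2, hfd, hql]
  linear_combination (dunklTransform k (mulX φ) l) * Complex.I_sq

/-- The Gaussian satisfies G' = -xG. The two intertwining relations, which for even functions
involve only the ordinary derivative, carry this equation over to its transform; the value 1 at 0
then fixes the solution. -/
theorem dunklTransform_gaussian {G : 𝓢(ℝ, ℂ)} (hG : ∀ x, G x = (Real.exp (-x ^ 2 / 2) : ℂ))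
    (l : ℝ) : dunklTransform k G l = G l := by
  have hGe : ∀ x, G (-x) = G x := fun x => by simp [hG]
  have hGd : ∀ x, ddx G x = -(mulX G x) := fun x => by
    refine (hasDerivAt_ddx G x).unique ?_
    rw [show ⇑G = _ from funext hG]
    have h1 : HasDerivAt (fun x : ℝ => -x ^ 2 / 2) (-x) x := by
      refine (((hasDerivAt_pow 2 x).fun_neg).div_const 2).congr_deriv ?_
      push_cast
      ring
    refine (h1.exp.ofReal_comp).congr_deriv ?_
    rw [mulX_apply, hG]
    push_cast
    ring
  have h1 := dunklTransform_dunklOperator (k := k) (φ := G) (p := G) (q := 0) hGe (by simp) (by simp)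
  obtain ⟨f, hf⟩ := exists_schwartz_dunklTransform (k := k) G
  have hfe : ∀ x, f (-x) = f x := fun x => by
    rw [hf, hf, dunklTransform, ← integral_neg_dunklMeasure, dunklTransform]
    simp [hGe]
  have h2 := dunklTransform_mulX (k := k) (φ := G) (f := f) (p := f) (q := 0) hf hfe (by simp) (by simp)
  have hGd' : (ddx G + (mulX (ddx 0) + (2 * k + 2 : ℂ) • 0) : 𝓢(ℝ, ℂ)) = (-1 : ℂ) • mulX G := by
    ext x
    have : ddx 0 x = 0 := (hasDerivAt_ddx 0 x).unique (hasDerivAt_const x 0)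
    simp [hGd, mulX_apply, this]
  have hfd' : ∀ x, (ddx f + (mulX (ddx 0) + (2 * k + 2 : ℂ) • 0) : 𝓢(ℝ, ℂ)) x = ddx f x := by
    intro x
    have : ddx 0 x = 0 := (hasDerivAt_ddx 0 x).unique (hasDerivAt_const x 0)
    simp [mulX_apply, this]
  have hode : ∀ x, ddx f x = -(x * f x) := fun x => by
    have a1 := h1 x
    have a2 := h2 x
    rw [hGd', dunklTransform_smul, a2, hfd', ← hf] at a1
    have : Complex.I * (ddx f x + x * f x) = 0 := by linear_combination -a1
    rcases mul_eq_zero.1 this with h | h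
    · exact absurd h Complex.I_ne_zero
    · linear_combination h
  have hconst : ∀ x, HasDerivAt (fun x : ℝ => f x * (Real.exp (x ^ 2 / 2) : ℂ)) 0 x := fun x => by
    have h1 : HasDerivAt (fun x : ℝ => x ^ 2 / 2) x x := by
      refine ((hasDerivAt_pow 2 x).div_const 2).congr_deriv ?_
      simp
    refine ((hasDerivAt_ddx f x).mul (h1.exp.ofReal_comp)).congr_deriv ?_
    rw [hode]
    push_cast
    ring
  have h3 := is_const_of_deriv_eq_zero (fun x => (hconst x).differentiableAt)
    (fun x => (hconst x).deriv) l 0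
  have h4 : f 0 = 1 := by
    rw [hf, dunklTransform]
    simp only [zero_mul, dunklExp_zero hk.out, mul_one, hG]
    exact integral_gaussian_dunklMeasure
  have h5 : (Real.exp (l ^ 2 / 2) : ℂ) * (Real.exp (-l ^ 2 / 2) : ℂ) = 1 := by
    rw [← Complex.ofReal_mul, ← Real.exp_add]
    simp [neg_div]
  simp only [h4] at h3
  rw [← hf, hG]
  simp only [ne_eq, OfNat.ofNat_ne_zero, not_false_eq_true, zero_pow, zero_div, Real.exp_zero,
    Complex.ofReal_one, mul_one] at h3
  linear_combination (Real.exp (-l ^ 2 / 2) : ℂ) * h3 - f l * h5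

/-- The inversion formula for the Dunkl transform. -/
theorem dunklTransform_dunklTransform (φ : 𝓢(ℝ, ℂ)) (y : ℝ) :
    dunklTransform k (dunklTransform k φ) y = φ (-y) := by
  obtain ⟨G, hG⟩ := exists_gaussian
  have hGy : G (-y) ≠ 0 := by
    rw [hG]
    exact_mod_cast (Real.exp_pos _).ne'
  -- Subtracting a multiple of the Gaussian makes the function vanish at -y, so it equals (x+y)χ.
  -- After two transforms x becomes multiplication by -l, so this part vanishes at l = y and only
  -- the fixed Gaussian term survives.
  obtain ⟨χ, hχ⟩ := exists_eq_sub_mul (φ - (φ (-y) / G (-y)) • G) (a := -y) (by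
    simp [div_mul_cancel₀ _ hGy])
  have hφ : φ = mulX χ + (y : ℂ) • χ + (φ (-y) / G (-y)) • G := by
    ext x
    have := hχ x
    simp only [sub_apply, smul_apply, smul_eq_mul, add_apply, mulX_apply] at this ⊢
    push_cast at this
    linear_combination this
  obtain ⟨f, hf⟩ := exists_schwartz_dunklTransform (k := k) χ
  obtain ⟨p, q, hp, hq, hpq⟩ := exists_even_add_mulX_even f
  have h1 : dunklTransform k φ = ⇑((Complex.I • (ddx p + (mulX (ddx q) + (2 * k + 2 : ℂ) • q)) +
      (y : ℂ) • f + (φ (-y) / G (-y)) • G) : 𝓢(ℝ, ℂ)) := by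
    funext l
    conv_lhs => rw [hφ]
    rw [dunklTransform_add, dunklTransform_add, dunklTransform_smul, dunklTransform_smul,
      dunklTransform_mulX hf hp hq hpq, dunklTransform_gaussian hG, ← hf]
    simp only [add_apply, smul_apply, smul_eq_mul]
  rw [h1, dunklTransform_add, dunklTransform_add, dunklTransform_smul, dunklTransform_smul,
    dunklTransform_smul, dunklTransform_gaussian hG, dunklTransform_dunklOperator hp hq hpq]
  have hGe : G (-y) = G y := by simp [hG]
  rw [← hGe, div_mul_cancel₀ _ hGy]
  linear_combination (y * dunklTransform k f y) * Complex.I_sq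

end

/-! ### The linear canonical Dunkl transform on the Schwartz space -/

/-- Complex conjugation of Schwartz functions. -/
noncomputable def conjSchwartz (φ : 𝓢(ℝ, ℂ)) : 𝓢(ℝ, ℂ) :=
  SchwartzMap.postcompCLM (𝕜 := ℝ) (Complex.conjCLE : ℂ →L[ℝ] ℂ) φ

theorem conjSchwartz_apply (φ : 𝓢(ℝ, ℂ)) (x : ℝ) :
    conjSchwartz φ x = starRingEnd ℂ (φ x) := rfl

/-- The chirp `exp(i c x² / 2)`. -/
noncomputable def chirp (c x : ℝ) : ℂ := Complex.exp (Complex.I / 2 * ((c * x ^ 2 : ℝ) : ℂ))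

theorem chirp_mul_conj (c x : ℝ) : chirp c x * starRingEnd ℂ (chirp c x) = 1 := by
  rw [chirp, ← Complex.exp_conj, ← Complex.exp_add, map_mul, map_div₀, Complex.conj_I,
    Complex.conj_ofReal, show starRingEnd ℂ (2 : ℂ) = 2 from map_ofNat _ 2, neg_div, neg_mul,
    add_neg_cancel, Complex.exp_zero]

theorem norm_chirp (c x : ℝ) : ‖chirp c x‖ = 1 := by
  have h := congrArg norm (chirp_mul_conj c x)
  rw [norm_mul, RCLike.norm_conj, norm_one] at h
  nlinarith [norm_nonneg (chirp c x)]

theorem continuous_chirp (c : ℝ) : Continuous (chirp c) := by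
  unfold chirp
  fun_prop

/-- The constant `(i b)^(-(k+1))`. -/
noncomputable def lcdtConst (k : ℝ) (M : Matrix.SpecialLinearGroup (Fin 2) ℝ) : ℂ :=
  ((Complex.I * M 0 1) ^ ((k : ℂ) + 1))⁻¹

theorem lcdtKernel_eq (k : ℝ) (M : Matrix.SpecialLinearGroup (Fin 2) ℝ) (l x : ℝ) :
    lcdtKernel k M l x = chirp (M 1 1 / M 0 1) l * chirp (M 0 0 / M 0 1) x *
      dunklExp k (l * x / M 0 1) := by
  rw [lcdtKernel, dunklKernel_eq_dunklExp, chirp, chirp, ← Complex.exp_add]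
  push_cast
  ring_nf

theorem lcdtConst_swapDiag (k : ℝ) (M : Matrix.SpecialLinearGroup (Fin 2) ℝ) :
    lcdtConst k (swapDiag M) = lcdtConst k M := by
  simp [lcdtConst, swapDiag]

/-- The exponent k+1 is real, so only |b| matters and the branch of the power drops out. The value
cancels the Jacobian in `integral_comp_div_dunklMeasure`. -/
theorem lcdtConst_mul_conj (k : ℝ) (M : Matrix.SpecialLinearGroup (Fin 2) ℝ) :
    lcdtConst k M * starRingEnd ℂ (lcdtConst k M) = ((1 / |M 0 1| ^ (2 * k + 2) : ℝ) : ℂ) := by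
  rw [Complex.mul_conj, Complex.normSq_eq_norm_sq, lcdtConst, norm_inv,
    show (k : ℂ) + 1 = ((k + 1 : ℝ) : ℂ) by push_cast; rfl, Complex.norm_cpow_real, norm_mul,
    Complex.norm_I, one_mul, Complex.norm_real, Real.norm_eq_abs, inv_pow, ← Real.rpow_natCast,
    ← Real.rpow_mul (abs_nonneg _), one_div]
  push_cast
  ring_nf

/-- The inverse transform `u ↦ conj C ∫ u(l) conj (E(l, x)) dμ_k(l)`. -/
noncomputable def lcdtInv (k : ℝ) (M : Matrix.SpecialLinearGroup (Fin 2) ℝ) (u : ℝ → ℂ) (x : ℝ) :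
    ℂ :=
  starRingEnd ℂ (lcdtConst k M) *
    ∫ l, u l * starRingEnd ℂ (lcdtKernel k M l x) ∂(dunklMeasure k)

theorem lcdt_swapDiag (k : ℝ) (M : Matrix.SpecialLinearGroup (Fin 2) ℝ) (φ : ℝ → ℂ) (x : ℝ) :
    lcdt k (swapDiag M) φ x = lcdtConst k M * ∫ l, φ l * lcdtKernel k M l x ∂(dunklMeasure k) := by
  rw [lcdt, ← lcdtConst, lcdtConst_swapDiag]
  simp only [lcdtKernel_swapDiag]

/-- Conjugation exchanges the transform of the swapped matrix with the inverse transform. A single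
inversion formula, applied to both matrices, thus gives surjectivity, Parseval and Plancherel. -/
theorem conj_lcdt_swapDiag (k : ℝ) (M : Matrix.SpecialLinearGroup (Fin 2) ℝ) (u : ℝ → ℂ) (x : ℝ) :
    starRingEnd ℂ (lcdt k (swapDiag M) u x) = lcdtInv k M (fun l => starRingEnd ℂ (u l)) x := by
  rw [lcdt_swapDiag, lcdtInv, map_mul, ← integral_conj]
  simp only [map_mul]

theorem conj_lcdt (k : ℝ) (M : Matrix.SpecialLinearGroup (Fin 2) ℝ) (u : ℝ → ℂ) (x : ℝ) :
    starRingEnd ℂ (lcdt k M u x) = lcdtInv k (swapDiag M) (fun l => starRingEnd ℂ (u l)) x := by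
  rw [lcdt, ← lcdtConst, lcdtInv, lcdtConst_swapDiag, map_mul, ← integral_conj]
  simp only [map_mul, lcdtKernel_swapDiag]

/-- The kernel is a chirp in l, a chirp in x and a dilated Dunkl kernel, so every property of the
canonical transform reduces to the Dunkl transform. -/
theorem lcdt_eq_dunklTransform {k : ℝ} {M : Matrix.SpecialLinearGroup (Fin 2) ℝ} {φ ψ : 𝓢(ℝ, ℂ)} (hψ : ∀ x, ψ x = chirp (M 0 0 / M 0 1) x * φ x)
    (l : ℝ) : lcdt k M φ l =
      lcdtConst k M * (chirp (M 1 1 / M 0 1) l * dunklTransform k ψ (l / M 0 1)) := by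
  rw [lcdt, lcdtConst, dunklTransform, ← integral_const_mul (chirp (M 1 1 / M 0 1) l)]
  congr 2
  funext x
  rw [lcdtKernel_eq, hψ, show l / M 0 1 * x = l * x / M 0 1 by ring]
  ring

section

variable {k : ℝ} [hk : Fact (-1 / 2 ≤ k)] {M : Matrix.SpecialLinearGroup (Fin 2) ℝ}

theorem norm_lcdtKernel_le (l x : ℝ) : ‖lcdtKernel k M l x‖ ≤ 1 := by
  rw [lcdtKernel_eq, norm_mul, norm_mul, norm_chirp, norm_chirp, one_mul, one_mul]
  exact norm_dunklExp_le_one hk.out _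

theorem continuous_lcdtKernel : Continuous (Function.uncurry (lcdtKernel k M)) := by
  have h1 : Continuous (dunklExp k) := (hasTemperateGrowth_dunklExp hk.out).1.continuous
  have h2 := continuous_chirp (M 1 1 / M 0 1)
  have h3 := continuous_chirp (M 0 0 / M 0 1)
  simp only [Function.uncurry_def, lcdtKernel_eq]
  fun_prop

theorem continuous_lcdtKernel_left (x : ℝ) : Continuous fun l => lcdtKernel k M l x :=
  continuous_lcdtKernel.uncurry_right x

theorem continuous_lcdtKernel_right (l : ℝ) : Continuous fun x => lcdtKernel k M l x :=
  continuous_lcdtKernel.uncurry_left l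

theorem continuous_conj_lcdtKernel :
    Continuous (Function.uncurry fun x l => starRingEnd ℂ (lcdtKernel k M l x)) := by
  have h := continuous_lcdtKernel (k := k) (M := M)
  have h2 := Complex.continuous_conj.comp (h.comp (continuous_swap (X := ℝ) (Y := ℝ)))
  simpa only [Function.uncurry_def, Function.comp_def, Prod.fst_swap, Prod.snd_swap] using h2

theorem integral_comp_div_dunklMeasure {b : ℝ} (hb : b ≠ 0) (f : ℝ → ℂ) :
    ∫ x, f (x / b) ∂(dunklMeasure k) =
      ((|b| ^ (2 * k + 2) : ℝ) : ℂ) * ∫ x, f x ∂(dunklMeasure k) := by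
  have hb' : 0 < |b| := abs_pos.2 hb
  rw [integral_dunklMeasure hk.out, integral_dunklMeasure hk.out]
  have h : ∀ x, (dunklWeight k x : ℂ) * f (x / b) = ((|b| ^ (2 * k + 1) : ℝ) : ℂ) *
      ((fun y => (dunklWeight k y : ℂ) * f y) (x / b)) := fun x => by
    have : dunklWeight k x = |b| ^ (2 * k + 1) * dunklWeight k (x / b) := by
      rw [dunklWeight, dunklWeight, abs_div, Real.div_rpow (abs_nonneg _) hb'.le]
      have := (Real.rpow_pos_of_pos hb' (2 * k + 1)).ne'
      field_simp
    rw [this]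
    push_cast
    ring
  simp_rw [h]
  rw [integral_const_mul, Measure.integral_comp_div (fun y => (dunklWeight k y : ℂ) * f y) b,
    Complex.real_smul, ← mul_assoc, ← Complex.ofReal_mul, ← Real.rpow_add_one hb'.ne']
  ring_nf

theorem exists_chirp_mul (c : ℝ) (φ : 𝓢(ℝ, ℂ)) : ∃ ψ : 𝓢(ℝ, ℂ), ∀ x, ψ x = chirp c x * φ x :=
  ⟨SchwartzMap.smulLeftCLM ℂ (chirp c) φ, fun x =>
    SchwartzMap.smulLeftCLM_apply_apply (hasTemperateGrowth_chirp c) φ x⟩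

theorem exists_comp_div {b : ℝ} (hb : b ≠ 0) (φ : 𝓢(ℝ, ℂ)) : ∃ ψ : 𝓢(ℝ, ℂ), ∀ x, ψ x = φ (x / b) :=
  ⟨SchwartzMap.compCLMOfContinuousLinearEquiv ℂ
    (ContinuousLinearEquiv.unitsEquivAut ℝ (Units.mk0 b⁻¹ (inv_ne_zero hb))) φ, fun x => by
      simp [div_eq_mul_inv]⟩

theorem exists_schwartz_lcdt (hb : M 0 1 ≠ 0) (φ : 𝓢(ℝ, ℂ)) :
    ∃ ψ : 𝓢(ℝ, ℂ), ∀ l, ψ l = lcdt k M φ l := by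
  obtain ⟨ψ₁, h₁⟩ := exists_chirp_mul (M 0 0 / M 0 1) φ
  obtain ⟨ψ₂, h₂⟩ := exists_schwartz_dunklTransform (k := k) ψ₁
  obtain ⟨ψ₃, h₃⟩ := exists_comp_div hb ψ₂
  obtain ⟨ψ₄, h₄⟩ := exists_chirp_mul (M 1 1 / M 0 1) ψ₃
  exact ⟨lcdtConst k M • ψ₄, fun l => by
    rw [smul_apply, smul_eq_mul, h₄, h₃, h₂, lcdt_eq_dunklTransform h₁]⟩

/-- The inversion formula for the linear canonical Dunkl transform. -/
theorem lcdtInv_lcdt (hb : M 0 1 ≠ 0) (φ : 𝓢(ℝ, ℂ)) (x : ℝ) :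
    lcdtInv k M (lcdt k M φ) x = φ x := by
  obtain ⟨ψ, hψ⟩ := exists_chirp_mul (M 0 0 / M 0 1) φ
  have h1 : ∀ l, lcdt k M φ l * starRingEnd ℂ (lcdtKernel k M l x) =
      (fun y => lcdtConst k M * starRingEnd ℂ (chirp (M 0 0 / M 0 1) x) *
        (dunklTransform k ψ y * dunklExp k (-x * y))) (l / M 0 1) := fun l => by
    rw [lcdt_eq_dunklTransform hψ, lcdtKernel_eq, map_mul, map_mul, ← dunklExp_neg,
      show -(l * x / M 0 1) = -x * (l / M 0 1) by ring]
    linear_combination (lcdtConst k M * starRingEnd ℂ (chirp (M 0 0 / M 0 1) x) *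
        (dunklTransform k ψ (l / M 0 1) * dunklExp k (-x * (l / M 0 1)))) *
        chirp_mul_conj (M 1 1 / M 0 1) l
  have hpos : |M 0 1| ^ (2 * k + 2) ≠ 0 := (Real.rpow_pos_of_pos (abs_pos.2 hb) _).ne'
  have h2 : lcdtConst k M * starRingEnd ℂ (lcdtConst k M) * ((|M 0 1| ^ (2 * k + 2) : ℝ) : ℂ) = 1 := by
    rw [lcdtConst_mul_conj, ← Complex.ofReal_mul, one_div_mul_cancel hpos, Complex.ofReal_one]
  have h4 := integral_comp_div_dunklMeasure (k := k) hb fun y =>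
    lcdtConst k M * starRingEnd ℂ (chirp (M 0 0 / M 0 1) x) *
      (dunklTransform k ψ y * dunklExp k (-x * y))
  rw [lcdtInv, integral_congr_ae (Eventually.of_forall h1), h4, integral_const_mul]
  have h3 := dunklTransform_dunklTransform (k := k) ψ (-x)
  rw [dunklTransform, neg_neg, hψ] at h3
  rw [h3]
  linear_combination (starRingEnd ℂ (chirp (M 0 0 / M 0 1) x) * chirp (M 0 0 / M 0 1) x * φ x) * h2
    + φ x * chirp_mul_conj (M 0 0 / M 0 1) x

/-- The transform is surjective on the Schwartz space. -/
theorem exists_lcdt_eq (hb : M 0 1 ≠ 0) (ψ : 𝓢(ℝ, ℂ)) :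
    ∃ φ : 𝓢(ℝ, ℂ), ∀ x, ψ x = lcdt k M φ x := by
  obtain ⟨χ, hχ⟩ := exists_schwartz_lcdt (k := k) (M := swapDiag M) hb (conjSchwartz ψ)
  -- The conjugate of D^(M') applied to conj ψ is the inverse transform of ψ.
  refine ⟨conjSchwartz χ, fun x => ?_⟩
  have h := lcdtInv_lcdt (k := k) (M := swapDiag M) hb (conjSchwartz ψ) x
  rw [← show _ = lcdt k (swapDiag M) (conjSchwartz ψ) from funext hχ] at h
  have h2 := conj_lcdt k M (conjSchwartz χ) x
  simp only [conjSchwartz_apply, Complex.conj_conj] at h2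
  rw [h, conjSchwartz_apply] at h2
  exact ((starRingEnd ℂ).injective h2).symm

theorem lcdtInv_eq_of_schwartz (hb : M 0 1 ≠ 0) (φ : 𝓢(ℝ, ℂ)) :
    ∃ ψ : 𝓢(ℝ, ℂ), (∀ x, ψ x = lcdtInv k M φ x) ∧ ∀ l, lcdt k M ψ l = φ l := by
  obtain ⟨ψ, hψ⟩ := exists_lcdt_eq (k := k) hb φ
  refine ⟨ψ, fun x => ?_, fun l => (hψ l).symm⟩
  rw [show ⇑φ = _ from funext hψ, lcdtInv_lcdt hb]

theorem integral_mul_integral_swap {u w : ℝ → ℂ} (hu : Integrable u (dunklMeasure k))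
    (hw : Integrable w (dunklMeasure k)) {E : ℝ → ℝ → ℂ} (hE : Continuous (Function.uncurry E))
    (hE1 : ∀ l x, ‖E l x‖ ≤ 1) :
    ∫ l, u l * ∫ x, w x * E l x ∂(dunklMeasure k) ∂(dunklMeasure k) =
      ∫ x, w x * ∫ l, u l * E l x ∂(dunklMeasure k) ∂(dunklMeasure k) := by
  have h1 : Integrable (Function.uncurry fun l x => u l * w x * E l x)
      ((dunklMeasure k).prod (dunklMeasure k)) := by
    refine (hu.mul_prod hw).mul_bdd (c := 1) hE.aestronglyMeasurable (Eventually.of_forall fun z => ?_)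
    exact hE1 z.1 z.2
  have h2 := integral_integral_swap h1
  simp_rw [← integral_const_mul]
  refine Eq.trans ?_ (h2.trans ?_)
  · refine integral_congr_ae (Eventually.of_forall fun l =>
      integral_congr_ae (Eventually.of_forall fun x => ?_))
    exact (mul_assoc _ _ _).symm
  · refine integral_congr_ae (Eventually.of_forall fun l =>
      integral_congr_ae (Eventually.of_forall fun x => ?_))
    simp only
    ring

/-- Parseval's identity. -/
theorem integral_mul_lcdt_swapDiag_lcdtInv (hb : M 0 1 ≠ 0) {u : ℝ → ℂ}
    (hu : Integrable u (dunklMeasure k)) (φ : 𝓢(ℝ, ℂ)) :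
    ∫ x, lcdtInv k M u x * lcdt k (swapDiag M) φ x ∂(dunklMeasure k) =
      ∫ l, u l * φ l ∂(dunklMeasure k) := by
  obtain ⟨ψ, hψ⟩ := exists_schwartz_lcdt (k := k) (M := swapDiag M) hb φ
  have h := integral_mul_integral_swap (k := k) (ψ.integrable) hu
    (E := fun x l => starRingEnd ℂ (lcdtKernel k M l x))
    continuous_conj_lcdtKernel
    (fun x l => by rw [RCLike.norm_conj]; exact norm_lcdtKernel_le l x)
  have h2 : ∀ x, lcdtInv k M u x * lcdt k (swapDiag M) φ x = starRingEnd ℂ (lcdtConst k M) *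
      (ψ x * ∫ l, u l * starRingEnd ℂ (lcdtKernel k M l x) ∂(dunklMeasure k)) := fun x => by
    rw [hψ, lcdtInv]; ring
  simp_rw [h2]
  rw [integral_const_mul, h, ← integral_const_mul]
  refine integral_congr_ae (Eventually.of_forall fun l => ?_)
  have h3 := lcdtInv_lcdt (k := k) (M := swapDiag M) hb φ l
  rw [← show _ = lcdt k (swapDiag M) φ from funext hψ, lcdtInv, lcdtConst_swapDiag] at h3
  simp only [lcdtKernel_swapDiag] at h3
  simp only
  rw [← h3]
  ring

theorem continuous_lcdtInv {u : ℝ → ℂ} (hu : Integrable u (dunklMeasure k)) :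
    Continuous (lcdtInv k M u) := by
  refine continuous_const.mul (continuous_of_dominated (bound := fun l => ‖u l‖) ?_ ?_ hu.norm ?_)
  · intro x
    exact hu.1.mul (Complex.continuous_conj.comp (continuous_lcdtKernel_left x)).aestronglyMeasurable
  · intro x
    refine Eventually.of_forall fun l => ?_
    rw [norm_mul, RCLike.norm_conj]
    exact mul_le_of_le_one_right (norm_nonneg _) (norm_lcdtKernel_le l x)
  · refine Eventually.of_forall fun l => ?_
    exact continuous_const.mul (Complex.continuous_conj.comp (continuous_lcdtKernel_right l))

theorem norm_lcdtInv_le {u : ℝ → ℂ} (hu : Integrable u (dunklMeasure k)) (x : ℝ) :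
    ‖lcdtInv k M u x‖ ≤ ‖lcdtConst k M‖ * ∫ l, ‖u l‖ ∂(dunklMeasure k) := by
  rw [lcdtInv, norm_mul, RCLike.norm_conj]
  gcongr
  refine norm_integral_le_of_norm_le hu.norm (Eventually.of_forall fun l => ?_)
  rw [norm_mul, RCLike.norm_conj]
  exact mul_le_of_le_one_right (norm_nonneg _) (norm_lcdtKernel_le l x)

/-- Plancherel's theorem for Schwartz functions. -/
theorem integral_norm_sq_lcdtInv (hb : M 0 1 ≠ 0) {φ ψ : 𝓢(ℝ, ℂ)}
    (hψ : ∀ x, ψ x = lcdtInv k M φ x) :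
    ∫ x, ‖ψ x‖ ^ 2 ∂(dunklMeasure k) = ∫ l, ‖φ l‖ ^ 2 ∂(dunklMeasure k) := by
  -- Parseval is tested on conj φ, whose transform under the swapped matrix is conj ψ.
  have h := integral_mul_lcdt_swapDiag_lcdtInv (k := k) hb φ.integrable (conjSchwartz φ)
  have h1 : ∀ x, lcdt k (swapDiag M) (conjSchwartz φ) x = starRingEnd ℂ (ψ x) := fun x => by
    have := conj_lcdt_swapDiag k M (conjSchwartz φ) x
    simp only [conjSchwartz_apply, Complex.conj_conj] at this
    rw [hψ, ← this, Complex.conj_conj]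
  simp only [h1, ← hψ, conjSchwartz_apply, Complex.mul_conj, Complex.normSq_eq_norm_sq] at h
  rw [integral_complex_ofReal, integral_complex_ofReal] at h
  exact_mod_cast h

end

/-! ### Distributions given by functions: uniqueness of representatives and transforms -/

section

variable {k : ℝ} {M : Matrix.SpecialLinearGroup (Fin 2) ℝ}

/-- Local integrability of F itself is not given, but F times the Gaussian is integrable. Testing
that product against smooth compactly supported g uses the Schwartz function gG, and the Gaussian
never vanishes. -/
theorem ae_eq_zero_of_integral_schwartz {F : ℝ → ℂ}
    (hF : ∀ φ : 𝓢(ℝ, ℂ), Integrable (fun x => F x * φ x) (dunklMeasure k) ∧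
      ∫ x, F x * φ x ∂(dunklMeasure k) = 0) : F =ᵐ[dunklMeasure k] 0 := by
  obtain ⟨G, hG⟩ := exists_gaussian
  have h := ae_eq_zero_of_integral_contDiff_smul_eq_zero (hF G).1.locallyIntegrable
    fun g hg hgc => by
      have h1 : HasCompactSupport (Complex.ofRealCLM ∘ g) := hgc.comp_left rfl
      have h2 : ContDiff ℝ ∞ (Complex.ofRealCLM ∘ g) := Complex.ofRealCLM.contDiff.comp hg
      let γ : 𝓢(ℝ, ℂ) := h1.toSchwartzMap h2
      have hγ : ∀ x, γ x = g x := fun x => rfl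
      have h3 : ∀ x, SchwartzMap.smulLeftCLM ℂ γ G x = g x * G x := fun x => by
        rw [SchwartzMap.smulLeftCLM_apply_apply γ.hasTemperateGrowth, hγ, smul_eq_mul]
      rw [← (hF (SchwartzMap.smulLeftCLM ℂ γ G)).2]
      refine integral_congr_ae (Eventually.of_forall fun x => ?_)
      simp only [h3, Complex.real_smul]
      ring
  filter_upwards [h] with x hx
  rcases mul_eq_zero.1 hx with h | h
  · exact h
  · rw [hG] at h
    exact absurd h (by exact_mod_cast (Real.exp_pos _).ne')

theorem HasLCDT.sub {T T' : 𝓢'(ℝ, ℂ)} {u u' : ℝ → ℂ} (h : HasLCDT k M T u)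
    (h' : HasLCDT k M T' u') : HasLCDT k M (T - T') fun l => u l - u' l := by
  intro φ
  have e : ∀ x, (u x - u' x) * φ x = u x * φ x - u' x * φ x := fun x => sub_mul _ _ _
  simp_rw [e]
  refine ⟨(h φ).1.sub (h' φ).1, fun ψ hψ => ?_⟩
  rw [integral_sub (h φ).1 (h' φ).1, ← (h φ).2 ψ hψ, ← (h' φ).2 ψ hψ]
  rfl

theorem IsFunction.sub {T T' : 𝓢'(ℝ, ℂ)} {F F' : ℝ → ℂ} (h : IsFunction k T F)
    (h' : IsFunction k T' F') : IsFunction k (T - T') fun x => F x - F' x := by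
  intro φ
  have e : ∀ x, (F x - F' x) * φ x = F x * φ x - F' x * φ x := fun x => sub_mul _ _ _
  simp_rw [e]
  refine ⟨(h φ).1.sub (h' φ).1, ?_⟩
  rw [integral_sub (h φ).1 (h' φ).1, ← (h φ).2, ← (h' φ).2]
  rfl

theorem hasLCDT_lcdtFun {T : 𝓢'(ℝ, ℂ)} {u : ℝ → ℂ} (h : HasLCDT k M T u) :
    HasLCDT k M T (lcdtFun k M T) := by
  have hex : ∃ u, HasLCDT k M T u := ⟨u, h⟩
  rw [lcdtFun, dif_pos hex]
  exact hex.choose_spec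

theorem IsFunction.ae_eq {T : 𝓢'(ℝ, ℂ)} {F F' : ℝ → ℂ} (h : IsFunction k T F)
    (h' : IsFunction k T F') : F =ᵐ[dunklMeasure k] F' := by
  have h0 := ae_eq_zero_of_integral_schwartz (k := k) (F := fun x => F x - F' x) fun φ => by
    have e : ∀ x, (F x - F' x) * φ x = F x * φ x - F' x * φ x := fun x => sub_mul _ _ _
    simp_rw [e]
    refine ⟨(h φ).1.sub (h' φ).1, ?_⟩
    rw [integral_sub (h φ).1 (h' φ).1, ← (h φ).2, ← (h' φ).2, sub_self]
  filter_upwards [h0] with x hx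
  exact sub_eq_zero.1 hx

end

section

variable {k : ℝ} [hk : Fact (-1 / 2 ≤ k)] {M : Matrix.SpecialLinearGroup (Fin 2) ℝ}

theorem integrable_mul_schwartz {F : ℝ → ℂ} (hF : MemLp F 2 (dunklMeasure k)) (φ : 𝓢(ℝ, ℂ)) :
    Integrable (fun x => F x * φ x) (dunklMeasure k) :=
  hF.integrable_mul (φ.memLp 2 (dunklMeasure k))

/-- The duality condition speaks only of those φ whose transform is represented by a Schwartz
function ψ; invariance of the Schwartz space provides such a ψ for every φ. -/
theorem HasLCDT.ae_eq (hb : M 0 1 ≠ 0) {T : 𝓢'(ℝ, ℂ)} {u u' : ℝ → ℂ} (h : HasLCDT k M T u)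
    (h' : HasLCDT k M T u') : u =ᵐ[dunklMeasure k] u' := by
  have h0 := ae_eq_zero_of_integral_schwartz (k := k) (F := fun x => u x - u' x) fun φ => by
    obtain ⟨ψ, hψ⟩ := exists_schwartz_lcdt (k := k) (M := swapDiag M) hb φ
    have e : ∀ x, (u x - u' x) * φ x = u x * φ x - u' x * φ x := fun x => sub_mul _ _ _
    simp_rw [e]
    refine ⟨(h φ).1.sub (h' φ).1, ?_⟩
    rw [integral_sub (h φ).1 (h' φ).1, ← (h φ).2 ψ hψ, ← (h' φ).2 ψ hψ, sub_self]
  filter_upwards [h0] with x hx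
  exact sub_eq_zero.1 hx

/-- Injectivity on distributions is dual to surjectivity on Schwartz functions: every test function
is a transform. -/
theorem HasLCDT.distribution_eq (hb : M 0 1 ≠ 0) {T T' : 𝓢'(ℝ, ℂ)} {u u' : ℝ → ℂ}
    (h : HasLCDT k M T u) (h' : HasLCDT k M T' u') (huu' : u =ᵐ[dunklMeasure k] u') : T = T' := by
  ext ψ
  obtain ⟨φ, hφ⟩ := exists_lcdt_eq (k := k) (M := swapDiag M) hb ψ
  rw [(h φ).2 ψ hφ, (h' φ).2 ψ hφ]
  exact integral_congr_ae (huu'.mono fun x hx => by simp only [hx])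

/-- If `D_k^M T` is integrable, then `T` is given by the inversion integral. -/
theorem HasLCDT.isFunction (hb : M 0 1 ≠ 0) {T : 𝓢'(ℝ, ℂ)} {u : ℝ → ℂ} (h : HasLCDT k M T u)
    (hu : Integrable u (dunklMeasure k)) : IsFunction k T (lcdtInv k M u) := by
  intro ψ
  refine ⟨ψ.integrable.bdd_mul (continuous_lcdtInv hu).aestronglyMeasurable
    (Eventually.of_forall (norm_lcdtInv_le hu)), ?_⟩
  obtain ⟨φ, hφ⟩ := exists_lcdt_eq (k := k) (M := swapDiag M) hb ψ
  rw [(h φ).2 ψ hφ, ← integral_mul_lcdt_swapDiag_lcdtInv hb hu]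
  simp only [hφ]

/-! ### Extension of the inverse transform to L² -/

/-- The inverse transform on the Schwartz space. -/
noncomputable def lcdtInvSchwartz (hb : M 0 1 ≠ 0) : 𝓢(ℝ, ℂ) →ₗ[ℂ] 𝓢(ℝ, ℂ) where
  toFun φ := (lcdtInv_eq_of_schwartz (k := k) hb φ).choose
  map_add' φ ψ := by
    ext x
    have h := fun φ => (lcdtInv_eq_of_schwartz (k := k) hb φ).choose_spec.1 x
    rw [add_apply, h, h, h, lcdtInv, lcdtInv, lcdtInv, ← mul_add, ← integral_add]
    · simp only [add_apply, add_mul]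
    all_goals
      refine Integrable.mul_bdd (c := 1) (SchwartzMap.integrable _)
        (Complex.continuous_conj.comp (continuous_lcdtKernel_left x)).aestronglyMeasurable
        (Eventually.of_forall fun l => ?_)
      rw [RCLike.norm_conj]
      exact norm_lcdtKernel_le l x
  map_smul' c φ := by
    ext x
    have h := fun φ => (lcdtInv_eq_of_schwartz (k := k) hb φ).choose_spec.1 x
    rw [smul_apply, h, h, lcdtInv, lcdtInv, RingHom.id_apply, smul_eq_mul, mul_left_comm,
      ← integral_const_mul c]
    simp only [smul_apply, smul_eq_mul, mul_assoc]

theorem lcdtInvSchwartz_apply (hb : M 0 1 ≠ 0) (φ : 𝓢(ℝ, ℂ)) (x : ℝ) :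
    lcdtInvSchwartz (k := k) hb φ x = lcdtInv k M φ x :=
  (lcdtInv_eq_of_schwartz (k := k) hb φ).choose_spec.1 x

theorem norm_toLp_lcdtInvSchwartz (hb : M 0 1 ≠ 0) (φ : 𝓢(ℝ, ℂ)) :
    ‖(lcdtInvSchwartz (k := k) hb φ).toLp 2 (dunklMeasure k)‖ = ‖φ.toLp 2 (dunklMeasure k)‖ := by
  rw [SchwartzMap.norm_toLp' two_ne_zero ENNReal.ofNat_ne_top,
    SchwartzMap.norm_toLp' two_ne_zero ENNReal.ofNat_ne_top]
  have h := integral_norm_sq_lcdtInv (k := k) hb (lcdtInvSchwartz_apply (k := k) hb φ)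
  simp only [ENNReal.toReal_ofNat, Real.rpow_two] at h ⊢
  rw [h]

/-- The inverse transform on `L²_k(ℝ)`. -/
noncomputable def lcdtInvL2 (hb : M 0 1 ≠ 0) :
    Lp ℂ 2 (dunklMeasure k) →L[ℂ] Lp ℂ 2 (dunklMeasure k) :=
  ((SchwartzMap.toLpCLM ℂ ℂ 2 (dunklMeasure k)).toLinearMap ∘ₗ
    lcdtInvSchwartz (k := k) hb).extendOfNorm (SchwartzMap.toLpCLM ℂ ℂ 2 (dunklMeasure k)).toLinearMap

/-- Density of Schwartz functions and the isometry on them are what determine the extension. -/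
theorem lcdtInvL2_toLp (hb : M 0 1 ≠ 0) (φ : 𝓢(ℝ, ℂ)) :
    lcdtInvL2 (k := k) hb (φ.toLp 2 (dunklMeasure k)) =
      (lcdtInvSchwartz (k := k) hb φ).toLp 2 (dunklMeasure k) :=
  LinearMap.extendOfNorm_eq
    (f := (SchwartzMap.toLpCLM ℂ ℂ 2 (dunklMeasure k)).toLinearMap ∘ₗ lcdtInvSchwartz (k := k) hb)
    (e := (SchwartzMap.toLpCLM ℂ ℂ 2 (dunklMeasure k)).toLinearMap)
    (SchwartzMap.denseRange_toLpCLM ENNReal.ofNat_ne_top)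
    ⟨1, fun φ => by rw [one_mul]; exact (norm_toLp_lcdtInvSchwartz hb φ).le⟩ φ

theorem norm_lcdtInvL2_le (hb : M 0 1 ≠ 0) (u : Lp ℂ 2 (dunklMeasure k)) :
    ‖lcdtInvL2 (k := k) hb u‖ ≤ ‖u‖ := by
  have := LinearMap.norm_extendOfNorm_apply_le
    (f := (SchwartzMap.toLpCLM ℂ ℂ 2 (dunklMeasure k)).toLinearMap ∘ₗ lcdtInvSchwartz (k := k) hb)
    (e := (SchwartzMap.toLpCLM ℂ ℂ 2 (dunklMeasure k)).toLinearMap)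
    (SchwartzMap.denseRange_toLpCLM ENNReal.ofNat_ne_top) 1
    (fun φ => by rw [one_mul]; exact (norm_toLp_lcdtInvSchwartz hb φ).le) u
  rwa [one_mul] at this

/-- Both sides are continuous in u and agree on the dense Schwartz functions by Parseval. -/
theorem toTemperedDistribution_lcdtInvL2 (hb : M 0 1 ≠ 0) {φ ψ : 𝓢(ℝ, ℂ)}
    (hψ : ∀ x, ψ x = lcdt k (swapDiag M) φ x) (u : Lp ℂ 2 (dunklMeasure k)) :
    Lp.toTemperedDistribution (lcdtInvL2 (k := k) hb u) ψ = Lp.toTemperedDistribution u φ := by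
  have hc : ∀ χ : 𝓢(ℝ, ℂ), Continuous fun u : Lp ℂ 2 (dunklMeasure k) =>
      Lp.toTemperedDistribution u χ := fun χ => by
    -- Pairing with χ is the L² inner product with conj χ, hence continuous.
    have h1 : ∀ u : Lp ℂ 2 (dunklMeasure k), Lp.toTemperedDistribution u χ =
        inner ℂ ((conjSchwartz χ).toLp 2 (dunklMeasure k)) u := fun u => by
      rw [Lp.toTemperedDistribution_apply, L2.inner_def]
      refine integral_congr_ae ?_
      filter_upwards [(conjSchwartz χ).coeFn_toLp 2 (dunklMeasure k)] with x hx
      rw [hx, conjSchwartz_apply]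
      simp [mul_comm]
    simp_rw [h1]
    fun_prop
  refine congrFun (DenseRange.equalizer
    (SchwartzMap.denseRange_toLpCLM (E := ℝ) (F := ℂ) (p := 2) (μ := dunklMeasure k)
      ENNReal.ofNat_ne_top) ((hc ψ).comp (lcdtInvL2 (k := k) hb).continuous) (hc φ) ?_) u
  funext χ
  have h := integral_mul_lcdt_swapDiag_lcdtInv (k := k) hb χ.integrable φ
  simp only [Function.comp, SchwartzMap.toLpCLM_apply, lcdtInvL2_toLp,
    Lp.toTemperedDistribution_apply]
  refine Eq.trans ?_ (h.trans ?_)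
  · refine integral_congr_ae ?_
    filter_upwards [(lcdtInvSchwartz (k := k) hb χ).coeFn_toLp 2 (dunklMeasure k)] with x hx
    rw [hx, lcdtInvSchwartz_apply, hψ, smul_eq_mul, mul_comm]
  · refine integral_congr_ae ?_
    filter_upwards [χ.coeFn_toLp 2 (dunklMeasure k)] with x hx
    rw [hx, smul_eq_mul, mul_comm]

/-- Every `u ∈ L²_k(ℝ)` is the transform of some `F ∈ L²_k(ℝ)`. -/
theorem exists_hasLCDT (hb : M 0 1 ≠ 0) {u : ℝ → ℂ} (hu : MemLp u 2 (dunklMeasure k)) :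
    ∃ (T : 𝓢'(ℝ, ℂ)) (F : ℝ → ℂ), MemLp F 2 (dunklMeasure k) ∧
      eLpNorm F 2 (dunklMeasure k) ≤ eLpNorm u 2 (dunklMeasure k) ∧ IsFunction k T F ∧
      HasLCDT k M T u := by
  let F := lcdtInvL2 (k := k) hb hu.toLp
  refine ⟨Lp.toTemperedDistribution F, F, Lp.memLp F, ?_, fun φ => ?_, fun φ => ?_⟩
  · have h := norm_lcdtInvL2_le (k := k) hb hu.toLp
    rw [Lp.norm_def, Lp.norm_def, ENNReal.toReal_le_toReal (Lp.eLpNorm_ne_top _)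
      (Lp.eLpNorm_ne_top _)] at h
    exact h.trans_eq (eLpNorm_congr_ae hu.coeFn_toLp)
  · refine ⟨integrable_mul_schwartz (Lp.memLp F) φ, ?_⟩
    rw [Lp.toTemperedDistribution_apply]
    simp only [smul_eq_mul, mul_comm]
  · refine ⟨integrable_mul_schwartz hu φ, fun ψ hψ => ?_⟩
    rw [toTemperedDistribution_lcdtInvL2 hb hψ, Lp.toTemperedDistribution_apply]
    refine integral_congr_ae ?_
    filter_upwards [hu.coeFn_toLp] with x hx
    rw [hx, smul_eq_mul, mul_comm]

end

/-! ### Truncation, and estimates for the denominator -/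

theorem tendsto_eLpNorm_indicator_Icc_sub {μ : Measure ℝ} {u : ℝ → ℂ} (hu : MemLp u 2 μ) :
    Tendsto (fun R : ℝ => eLpNorm (fun l => (Set.Icc (-R) R).indicator u l - u l) 2 μ)
      atTop (𝓝 0) := by
  have hu2 : ∫⁻ l, ‖u l‖ₑ ^ (2 : ℝ) ∂μ ≠ ⊤ := by
    have := (lintegral_rpow_enorm_lt_top_of_eLpNorm_lt_top two_ne_zero ENNReal.ofNat_ne_top hu.2).ne
    simpa using this
  have hlim : Tendsto (fun R : ℝ => ∫⁻ l, ‖(Set.Icc (-R) R).indicator u l - u l‖ₑ ^ (2 : ℝ) ∂μ)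
      atTop (𝓝 (∫⁻ _, 0 ∂μ)) := by
    refine tendsto_lintegral_filter_of_dominated_convergence' (fun l => ‖u l‖ₑ ^ (2 : ℝ)) ?_ ?_ hu2 ?_
    · exact Eventually.of_forall fun R =>
        (((hu.1.indicator measurableSet_Icc).sub hu.1).enorm.pow_const _)
    · refine Eventually.of_forall fun R => Eventually.of_forall fun l => ?_
      by_cases hl : l ∈ Set.Icc (-R) R
      · simp [hl]
      · simp [hl]
    · refine Eventually.of_forall fun l => tendsto_const_nhds.congr' ?_
      filter_upwards [eventually_ge_atTop |l|] with R hR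
      have : l ∈ Set.Icc (-R) R := abs_le.1 hR
      simp [this]
  have h2 := (ENNReal.continuous_rpow_const (y := 1 / 2)).tendsto _ |>.comp hlim
  simp only [lintegral_zero] at h2
  rw [ENNReal.zero_rpow_of_pos (by norm_num)] at h2
  refine h2.congr fun R => ?_
  rw [eLpNorm_eq_lintegral_rpow_enorm_toReal two_ne_zero ENNReal.ofNat_ne_top]
  simp

/-- The denominator `ρ (1 + l²)^s + 1`. -/
noncomputable def regDenom (s ρ l : ℝ) : ℝ := ρ * (1 + l ^ 2) ^ s + 1

theorem continuous_one_add_sq_rpow (s : ℝ) : Continuous fun l : ℝ => (1 + l ^ 2) ^ s :=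
  (by fun_prop : Continuous fun l : ℝ => 1 + l ^ 2).rpow_const
    fun l => Or.inl (by positivity : (0 : ℝ) < 1 + l ^ 2).ne'

theorem continuous_regDenom (s ρ : ℝ) : Continuous (regDenom s ρ) :=
  (continuous_const.mul (continuous_one_add_sq_rpow s)).add continuous_const

theorem one_le_regDenom (s : ℝ) {ρ : ℝ} (hρ : 0 < ρ) (l : ℝ) : 1 ≤ regDenom s ρ l := by
  have : 0 ≤ ρ * (1 + l ^ 2) ^ s := by positivity
  rw [regDenom]
  linarith

/-- Only the part ρ(1+l²)^s of the denominator is kept. -/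
theorem rpow_div_regDenom_le (s : ℝ) {ρ : ℝ} (hρ : 0 < ρ) (t l : ℝ) :
    (1 + l ^ 2) ^ t / regDenom s ρ l ≤ 1 / ρ * (1 + l ^ 2) ^ (-(s - t)) := by
  have h0 : (0 : ℝ) < 1 + l ^ 2 := by positivity
  have h1 : (1 + l ^ 2) ^ t = (1 + l ^ 2) ^ s * (1 + l ^ 2) ^ (-(s - t)) := by
    rw [← Real.rpow_add h0]; ring_nf
  rw [div_le_iff₀ (by linarith [one_le_regDenom s hρ l]), h1, regDenom]
  have h2 : 0 ≤ 1 / ρ * (1 + l ^ 2) ^ (-(s - t)) := by positivity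
  have h3 : 1 / ρ * (1 + l ^ 2) ^ (-(s - t)) * (ρ * (1 + l ^ 2) ^ s) =
      (1 + l ^ 2) ^ s * (1 + l ^ 2) ^ (-(s - t)) := by
    field_simp
  linarith

section

variable {k : ℝ} {M : Matrix.SpecialLinearGroup (Fin 2) ℝ}

/-- The transform of the kernel section at `y`. -/
noncomputable def sectionTransform (k : ℝ) (M : Matrix.SpecialLinearGroup (Fin 2) ℝ)
    (s ρ y l : ℝ) : ℂ :=
  lcdtConst k M * lcdtKernel k M l y / (regDenom s ρ l : ℂ)

theorem rpow_neg_mul_rpow_mul {s : ℝ} (u : ℝ → ℂ) (l : ℝ) :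
    (((1 + l ^ 2) ^ (-(s / 2)) : ℝ) : ℂ) * ((((1 + l ^ 2) ^ (s / 2) : ℝ) : ℂ) * u l) = u l := by
  have h0 : (0 : ℝ) < 1 + l ^ 2 := by positivity
  rw [← mul_assoc, ← Complex.ofReal_mul, ← Real.rpow_add h0, neg_add_cancel, Real.rpow_zero,
    Complex.ofReal_one, one_mul]

theorem div_regDenom_eq_mul {s ρ : ℝ} (g : ℝ → ℂ) (l : ℝ) :
    g l / (regDenom s ρ l : ℂ) = g l * ((1 / regDenom s ρ l : ℝ) : ℂ) := by
  push_cast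
  ring

theorem truncatedKernel_eq_lcdtInv (s ρ R x y : ℝ) :
    truncatedKernel k M s ρ R x y =
      lcdtInv k M ((Set.Icc (-R) R).indicator (sectionTransform k M s ρ y)) x := by
  rw [truncatedKernel, lcdtInv, ← lcdtConst_mul_conj, mul_comm (lcdtConst k M), mul_assoc,
    ← integral_const_mul, ← integral_indicator measurableSet_Icc]
  congr 2
  funext l
  by_cases hl : l ∈ Set.Icc (-R) R
  · simp only [Set.indicator_of_mem hl, sectionTransform, regDenom]
    ring
  · simp only [Set.indicator_of_notMem hl, zero_mul]

theorem integrable_mul_conj {u v : ℝ → ℂ} (hu : MemLp u 2 (dunklMeasure k))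
    (hv : MemLp v 2 (dunklMeasure k)) :
    Integrable (fun l => u l * starRingEnd ℂ (v l)) (dunklMeasure k) :=
  hu.integrable_mul hv.star

theorem memLp_div_regDenom {s ρ : ℝ} (hρ : 0 < ρ) {g : ℝ → ℂ}
    (hg : MemLp g 2 (dunklMeasure k)) :
    MemLp (fun l => g l / (regDenom s ρ l : ℂ)) 2 (dunklMeasure k) := by
  have hd0 : ∀ l, 0 < regDenom s ρ l := fun l => by linarith [one_le_regDenom s hρ l]
  simp only [div_regDenom_eq_mul]
  refine hg.mono (hg.1.mul (Complex.continuous_ofReal.comp (continuous_const.div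
    (continuous_regDenom s ρ) fun l => (hd0 l).ne')).aestronglyMeasurable)
    (Eventually.of_forall fun l => ?_)
  have := hd0 l
  rw [norm_mul, Complex.norm_real, Real.norm_of_nonneg (by positivity)]
  exact mul_le_of_le_one_right (norm_nonneg _) (by
    rw [one_div]; exact inv_le_one_of_one_le₀ (one_le_regDenom s hρ l))

/-- Dividing by the denominator absorbs the weight, since (1+l²)^(s/2) is at most the denominator
over ρ; no decay of g is needed. -/
theorem mem_sobolevSpace_of_hasLCDT {s ρ : ℝ} (hs : 0 ≤ s) (hρ : 0 < ρ) {g : ℝ → ℂ}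
    (hg : MemLp g 2 (dunklMeasure k)) {T : 𝓢'(ℝ, ℂ)}
    (hT : HasLCDT k M T fun l => g l / (regDenom s ρ l : ℂ)) : T ∈ sobolevSpace k M s := by
  have hd0 : ∀ l, 0 < regDenom s ρ l := fun l => by linarith [one_le_regDenom s hρ l]
  refine ⟨_, hT, (hg.const_mul ((1 / ρ : ℝ) : ℂ)).mono ?_ (Eventually.of_forall fun l => ?_)⟩
  · refine (Complex.continuous_ofReal.comp (continuous_one_add_sq_rpow _)).aestronglyMeasurable.mul ?_
    simp only [div_eq_mul_inv]
    exact hg.1.mul (((Complex.continuous_ofReal.comp (continuous_regDenom s ρ)).inv₀ fun l =>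
      Complex.ofReal_ne_zero.2 (hd0 l).ne').aestronglyMeasurable)
  · have h0 : (1 : ℝ) ≤ 1 + l ^ 2 := by nlinarith [sq_nonneg l]
    have h1 := rpow_div_regDenom_le s hρ (s / 2) l
    have h2 : (1 + l ^ 2) ^ (-(s - s / 2)) ≤ 1 :=
      Real.rpow_le_one_of_one_le_of_nonpos h0 (by linarith)
    rw [norm_mul, norm_div, norm_mul, Complex.norm_real, Complex.norm_real, Complex.norm_real,
      Real.norm_of_nonneg (by positivity), Real.norm_of_nonneg (hd0 l).le,
      Real.norm_of_nonneg (by positivity)]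
    calc (1 + l ^ 2) ^ (s / 2) * (‖g l‖ / regDenom s ρ l)
        = (1 + l ^ 2) ^ (s / 2) / regDenom s ρ l * ‖g l‖ := by ring
      _ ≤ 1 / ρ * ‖g l‖ := mul_le_mul_of_nonneg_right
        (h1.trans (mul_le_of_le_one_right (by positivity) h2)) (norm_nonneg _)

end

/-! ### Kernel sections and the reproducing property -/

section

variable {k : ℝ} [hk : Fact (-1 / 2 ≤ k)] {M : Matrix.SpecialLinearGroup (Fin 2) ℝ}

/-- The square behaves like |l|^(-4t), integrable against |l|^(2k+1) dl because 4t > 2k+2. Both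
thresholds on s come from here. -/
theorem memLp_one_add_sq_rpow {t : ℝ} (ht : (k + 1) / 2 < t) :
    MemLp (fun l : ℝ => (((1 + l ^ 2) ^ (-t) : ℝ) : ℂ)) 2 (dunklMeasure k) := by
  have hk' := hk.out
  have hc := continuous_one_add_sq_rpow (-t)
  have hm : AEStronglyMeasurable (fun l : ℝ => (((1 + l ^ 2) ^ (-t) : ℝ) : ℂ)) (dunklMeasure k) :=
    (Complex.continuous_ofReal.comp hc).aestronglyMeasurable
  refine (memLp_two_iff_integrable_sq_norm hm).2 ?_
  refine ((integrable_one_add_abs_rpow hk' (r := 4 * t) (by linarith)).const_mul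
    (2 ^ (2 * t))).mono' ?_ (Eventually.of_forall fun l => ?_)
  · exact ((Complex.continuous_ofReal.comp hc).norm.pow 2).aestronglyMeasurable
  · have h0 : (0 : ℝ) < 1 + l ^ 2 := by positivity
    have h1 : (0 : ℝ) < 1 + |l| := by positivity
    have h2 : (1 + |l|) ^ 2 / 2 ≤ 1 + l ^ 2 := by nlinarith [sq_abs l, sq_nonneg (|l| - 1)]
    have h3 := Real.rpow_le_rpow_of_nonpos (by positivity) h2 (by linarith : -(2 * t) ≤ 0)
    rw [Complex.norm_real, Real.norm_of_nonneg (by positivity), Real.norm_of_nonneg (by positivity),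
      ← Real.rpow_mul_natCast h0.le]
    push_cast
    rw [show -t * 2 = -(2 * t) by ring]
    refine h3.trans_eq ?_
    rw [Real.div_rpow (by positivity) (by positivity), ← Real.rpow_natCast, ← Real.rpow_mul h1.le,
      Real.rpow_neg zero_le_two, div_inv_eq_mul, mul_comm]
    congr 2
    push_cast
    ring

theorem continuous_sectionTransform (s : ℝ) {ρ : ℝ} (hρ : 0 < ρ) (y : ℝ) :
    Continuous (sectionTransform k M s ρ y) := by
  refine (continuous_const.mul (continuous_lcdtKernel_left y)).div
    (Complex.continuous_ofReal.comp (continuous_regDenom s ρ)) fun l => ?_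
  exact_mod_cast (by linarith [one_le_regDenom s hρ l] : 0 < regDenom s ρ l).ne'

theorem norm_sectionTransform_le (s : ℝ) {ρ : ℝ} (hρ : 0 < ρ) (y l : ℝ) :
    ‖sectionTransform k M s ρ y l‖ ≤ ‖lcdtConst k M‖ / regDenom s ρ l := by
  have h0 : 0 < regDenom s ρ l := by linarith [one_le_regDenom s hρ l]
  rw [sectionTransform, norm_div, Complex.norm_real, Real.norm_of_nonneg h0.le, norm_mul]
  gcongr
  exact mul_le_of_le_one_right (norm_nonneg _) (norm_lcdtKernel_le l y)

/-- Taking t = 0 needs s > (k+1)/2 and gives sections in L²; taking t = s/2 needs s > k+1 and gives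
sections in the Sobolev space. -/
theorem memLp_rpow_mul_sectionTransform {s ρ t : ℝ} (hρ : 0 < ρ) (ht : (k + 1) / 2 < s - t) (y : ℝ) :
    MemLp (fun l : ℝ => (((1 + l ^ 2) ^ t : ℝ) : ℂ) * sectionTransform k M s ρ y l) 2
      (dunklMeasure k) := by
  refine ((memLp_one_add_sq_rpow ht).const_mul ((‖lcdtConst k M‖ * (1 / ρ) : ℝ) : ℂ)).mono
    ((Complex.continuous_ofReal.comp (continuous_one_add_sq_rpow t)).mul
      (continuous_sectionTransform s hρ y)).aestronglyMeasurable (Eventually.of_forall fun l => ?_)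
  have h0 : (0 : ℝ) < 1 + l ^ 2 := by positivity
  rw [norm_mul, norm_mul, Complex.norm_real, Complex.norm_real, Complex.norm_real,
    Real.norm_of_nonneg (by positivity), Real.norm_of_nonneg (by positivity),
    Real.norm_of_nonneg (by positivity)]
  calc (1 + l ^ 2) ^ t * ‖sectionTransform k M s ρ y l‖
      ≤ (1 + l ^ 2) ^ t * (‖lcdtConst k M‖ / regDenom s ρ l) := by
        gcongr
        exact norm_sectionTransform_le s hρ y l
    _ = ‖lcdtConst k M‖ * ((1 + l ^ 2) ^ t / regDenom s ρ l) := by ring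
    _ ≤ ‖lcdtConst k M‖ * (1 / ρ * (1 + l ^ 2) ^ (-(s - t))) := by
        gcongr
        exact rpow_div_regDenom_le s hρ t l
    _ = _ := by ring

theorem memLp_sectionTransform {s ρ : ℝ} (hs : (k + 1) / 2 < s) (hρ : 0 < ρ) (y : ℝ) :
    MemLp (sectionTransform k M s ρ y) 2 (dunklMeasure k) := by
  have h := memLp_rpow_mul_sectionTransform (k := k) (M := M) (s := s) (t := 0) hρ (by linarith) y
  simpa using h

theorem isKernelSection_of_hasLCDT (hb : M 0 1 ≠ 0) {s ρ y : ℝ} (hs : (k + 1) / 2 < s) (hρ : 0 < ρ)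
    {T : 𝓢'(ℝ, ℂ)} (hT : HasLCDT k M T (sectionTransform k M s ρ y)) :
    IsKernelSection k M s ρ y T := by
  have hu := memLp_sectionTransform (M := M) hs hρ y
  obtain ⟨T₀, F, hF, -, hTF, hT₀⟩ := exists_hasLCDT (k := k) hb hu
  obtain rfl := hT.distribution_eq hb hT₀ (EventuallyEq.refl _ _)
  refine ⟨F, hF, ?_, hTF⟩
  refine tendsto_of_tendsto_of_tendsto_of_le_of_le tendsto_const_nhds
    (tendsto_eLpNorm_indicator_Icc_sub hu) (fun _ => zero_le) fun R => ?_
  have hR : MemLp ((Set.Icc (-R) R).indicator (sectionTransform k M s ρ y)) 2 (dunklMeasure k) :=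
    hu.indicator measurableSet_Icc
  have hR1 : Integrable ((Set.Icc (-R) R).indicator (sectionTransform k M s ρ y))
      (dunklMeasure k) :=
    (integrable_indicator_iff measurableSet_Icc).2
      (continuous_sectionTransform s hρ y).continuousOn.integrableOn_Icc
  obtain ⟨TR, -, -, -, -, hTR⟩ := exists_hasLCDT (k := k) hb hR
  obtain ⟨T', F', -, hF', hTF', hT'⟩ := exists_hasLCDT (k := k) hb (hR.sub hu)
  have hsub := hTR.sub hT
  obtain rfl := hT'.distribution_eq hb hsub (EventuallyEq.refl _ _)
  -- The truncated transform is integrable, so its distribution is the pointwise inversion integral,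
  -- that is, the truncated kernel. Its difference from F is therefore a.e. the L² inverse F' of the
  -- truncation error, whose norm is controlled by that error.
  have hae := ((hTR.isFunction hb hR1).sub hTF).ae_eq hTF'
  have e : (fun x => truncatedKernel k M s ρ R x y - F x) = fun x =>
      lcdtInv k M ((Set.Icc (-R) R).indicator (sectionTransform k M s ρ y)) x - F x := by
    funext x
    rw [truncatedKernel_eq_lcdtInv]
  simp only [e]
  rw [eLpNorm_congr_ae hae]
  exact hF'

/-- `lcdtFun` is a chosen representative; a.e. uniqueness transfers the weighted bound from the
witness of membership. -/
theorem memLp_rpow_mul_lcdtFun (hb : M 0 1 ≠ 0) {s : ℝ} {T : 𝓢'(ℝ, ℂ)}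
    (hT : T ∈ sobolevSpace k M s) : HasLCDT k M T (lcdtFun k M T) ∧
      MemLp (fun l : ℝ => (((1 + l ^ 2) ^ (s / 2) : ℝ) : ℂ) * lcdtFun k M T l) 2
        (dunklMeasure k) := by
  obtain ⟨u, hu, hu2⟩ := hT
  have h := hasLCDT_lcdtFun hu
  refine ⟨h, hu2.ae_eq ?_⟩
  filter_upwards [hu.ae_eq hb h] with l hl
  rw [hl]

theorem memLp_lcdtFun (hb : M 0 1 ≠ 0) {s : ℝ} (hs : 0 ≤ s) {T : 𝓢'(ℝ, ℂ)}
    (hT : T ∈ sobolevSpace k M s) : MemLp (lcdtFun k M T) 2 (dunklMeasure k) := by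
  have h := (memLp_rpow_mul_lcdtFun hb hT).2
  have hc := Complex.continuous_ofReal.comp (continuous_one_add_sq_rpow (-(s / 2)))
  have h2 : MemLp (fun l : ℝ => (((1 + l ^ 2) ^ (-(s / 2)) : ℝ) : ℂ) *
      ((((1 + l ^ 2) ^ (s / 2) : ℝ) : ℂ) * lcdtFun k M T l)) 2 (dunklMeasure k) := by
    refine h.mono (hc.aestronglyMeasurable.mul h.1) (Eventually.of_forall fun l => ?_)
    rw [norm_mul]
    refine mul_le_of_le_one_left (norm_nonneg _) ?_
    rw [Complex.norm_real, Real.norm_of_nonneg (by positivity)]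
    exact Real.rpow_le_one_of_one_le_of_nonpos (by nlinarith [sq_nonneg l]) (by linarith)
  simpa only [rpow_neg_mul_rpow_mul] using h2

/-- Cauchy-Schwarz against the weight (1+l²)^(-s/2), which is in L² exactly under the use made here
of s/2 > (k+1)/2. -/
theorem integrable_lcdtFun (hb : M 0 1 ≠ 0) {s : ℝ} (hs : k + 1 < s) {T : 𝓢'(ℝ, ℂ)}
    (hT : T ∈ sobolevSpace k M s) : Integrable (lcdtFun k M T) (dunklMeasure k) := by
  have h := (memLp_rpow_mul_lcdtFun hb hT).2
  have h2 := (memLp_one_add_sq_rpow (k := k) (t := s / 2) (by linarith)).integrable_mul h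
  refine h2.congr (Eventually.of_forall fun l => ?_)
  exact rpow_neg_mul_rpow_mul (s := s) (lcdtFun k M T) l

/-- The two terms of the inner product add up to the weight ρ(1+l²)^s + 1, which cancels the
denominator of the section; what remains is the inversion integral of f at y. -/
theorem isReproducingKernel_of_hasLCDT (hb : M 0 1 ≠ 0) {s ρ : ℝ} (hs : k + 1 < s) (hρ : 0 < ρ)
    {κ : ℝ → 𝓢'(ℝ, ℂ)} (hκ : ∀ y, HasLCDT k M (κ y) (sectionTransform k M s ρ y)) :
    IsReproducingKernel k M s ρ κ := by
  have hk' := hk.out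
  have hmem : ∀ y, κ y ∈ sobolevSpace k M s := fun y =>
    ⟨_, hκ y, memLp_rpow_mul_sectionTransform hρ (by linarith) y⟩
  refine ⟨hmem, fun f hf => ?_⟩
  have hfi := integrable_lcdtFun hb hs hf
  have hfd := memLp_rpow_mul_lcdtFun hb hf
  refine ⟨lcdtInv k M (lcdtFun k M f), continuous_lcdtInv hfi, hfd.1.isFunction hb hfi, fun y => ?_⟩
  have hv := memLp_rpow_mul_lcdtFun hb (hmem y)
  have hae := hv.1.ae_eq hb (hκ y)
  have i1 := integrable_mul_conj hfd.2 hv.2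
  have i2 := integrable_mul_conj (memLp_lcdtFun hb (by linarith) hf)
    (memLp_lcdtFun hb (by linarith) (hmem y))
  have e1 : ∀ l : ℝ, (((1 + l ^ 2) ^ (s / 2) : ℝ) : ℂ) * lcdtFun k M f l *
      starRingEnd ℂ ((((1 + l ^ 2) ^ (s / 2) : ℝ) : ℂ) * lcdtFun k M (κ y) l) =
      (((1 + l ^ 2) ^ s : ℝ) : ℂ) * lcdtFun k M f l * starRingEnd ℂ (lcdtFun k M (κ y) l) := by
    intro l
    have h0 : (0 : ℝ) < 1 + l ^ 2 := by positivity
    have : (1 + l ^ 2) ^ s = (1 + l ^ 2) ^ (s / 2) * (1 + l ^ 2) ^ (s / 2) := by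
      rw [← Real.rpow_add h0, add_halves]
    rw [this, map_mul, Complex.conj_ofReal]
    push_cast
    ring
  simp only [e1] at i1
  rw [regInner, sobolevInner, l2Inner, ← integral_const_mul, ← integral_add (i1.const_mul _) i2,
    lcdtInv, ← integral_const_mul]
  refine integral_congr_ae ?_
  filter_upwards [hae] with l hl
  have h0 : (regDenom s ρ l : ℂ) ≠ 0 := by
    exact_mod_cast (by linarith [one_le_regDenom s hρ l] : 0 < regDenom s ρ l).ne'
  rw [hl, sectionTransform, map_div₀, map_mul, Complex.conj_ofReal]
  field_simp
  rw [regDenom]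
  push_cast
  ring

/-! ### The Tikhonov functional and its minimizer -/

/-- The part of the functional that does not depend on its argument. -/
noncomputable def tikhonovMin (k s ρ : ℝ) (g : ℝ → ℂ) : ℝ :=
  ∫ l, (‖g l‖ ^ 2 - ‖g l‖ ^ 2 / regDenom s ρ l) ∂(dunklMeasure k)

theorem norm_sq_completion {m : ℝ} (hm : 1 ≤ m) (g u : ℂ) :
    (m - 1) * ‖u‖ ^ 2 + ‖g - u‖ ^ 2 = m * ‖u - g / m‖ ^ 2 + (‖g‖ ^ 2 - ‖g‖ ^ 2 / m) := by
  have h0 : m ≠ 0 := by linarith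
  simp only [← Complex.normSq_eq_norm_sq, Complex.normSq_apply, Complex.sub_re, Complex.sub_im,
    Complex.div_ofReal_re, Complex.div_ofReal_im]
  field_simp
  ring

/-- `norm_sq_completion` with m = `regDenom s ρ l` is integrated. Integrability is part of the
conclusion because a vanishing integral must later force its nonnegative integrand to vanish a.e. -/
theorem tikhonov_eq (hb : M 0 1 ≠ 0) {s ρ : ℝ} (hs : 0 ≤ s) (hρ : 0 < ρ) {g : ℝ → ℂ}
    (hg : MemLp g 2 (dunklMeasure k)) {T : 𝓢'(ℝ, ℂ)} (hT : T ∈ sobolevSpace k M s) :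
    Integrable (fun l => regDenom s ρ l * ‖lcdtFun k M T l - g l / (regDenom s ρ l : ℂ)‖ ^ 2)
      (dunklMeasure k) ∧
    tikhonov k M s ρ g T = tikhonovMin k s ρ g +
      ∫ l, regDenom s ρ l * ‖lcdtFun k M T l - g l / (regDenom s ρ l : ℂ)‖ ^ 2
        ∂(dunklMeasure k) := by
  set u := lcdtFun k M T with hu
  have hu2 := memLp_lcdtFun hb hs hT
  have hw := (memLp_rpow_mul_lcdtFun hb hT).2
  rw [← hu] at hu2 hw
  have iw : Integrable (fun l : ℝ => (1 + l ^ 2) ^ s * ‖u l‖ ^ 2) (dunklMeasure k) := by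
    refine ((memLp_two_iff_integrable_sq_norm hw.1).1 hw).congr (Eventually.of_forall fun l => ?_)
    have h0 : (0 : ℝ) < 1 + l ^ 2 := by positivity
    simp only
    rw [norm_mul, mul_pow, Complex.norm_real, Real.norm_of_nonneg (by positivity),
      ← Real.rpow_mul_natCast h0.le]
    norm_num
  have igu := (memLp_two_iff_integrable_sq_norm (hg.sub hu2).1).1 (hg.sub hu2)
  simp only [Pi.sub_apply] at igu
  have ig := (memLp_two_iff_integrable_sq_norm hg.1).1 hg
  have ig' : Integrable (fun l => ‖g l‖ ^ 2 - ‖g l‖ ^ 2 / regDenom s ρ l) (dunklMeasure k) := by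
    refine ig.sub (ig.mono (ig.1.mul (((continuous_regDenom s ρ).inv₀ fun l =>
      (by linarith [one_le_regDenom s hρ l] : 0 < regDenom s ρ l).ne').aestronglyMeasurable))
      (Eventually.of_forall fun l => ?_))
    have h1 := one_le_regDenom s hρ l
    rw [Real.norm_of_nonneg (by positivity), Real.norm_of_nonneg (by positivity), div_eq_mul_inv]
    exact mul_le_of_le_one_right (by positivity) (inv_le_one_of_one_le₀ h1)
  have key : ∀ l, regDenom s ρ l * ‖u l - g l / (regDenom s ρ l : ℂ)‖ ^ 2 =
      ρ * ((1 + l ^ 2) ^ s * ‖u l‖ ^ 2) + ‖g l - u l‖ ^ 2 -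
        (‖g l‖ ^ 2 - ‖g l‖ ^ 2 / regDenom s ρ l) := fun l => by
    have h := norm_sq_completion (one_le_regDenom s hρ l) (g l) (u l)
    have h2 : regDenom s ρ l - 1 = ρ * (1 + l ^ 2) ^ s := by rw [regDenom]; ring
    rw [h2] at h
    linarith
  have isum := (iw.const_mul ρ).add igu
  have hn : sobolevNorm k M s T ^ 2 = ∫ l : ℝ, (1 + l ^ 2) ^ s * ‖u l‖ ^ 2 ∂(dunklMeasure k) := by
    have h1 : sobolevInner k M s T T =
        ((∫ l : ℝ, (1 + l ^ 2) ^ s * ‖u l‖ ^ 2 ∂(dunklMeasure k) : ℝ) : ℂ) := by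
      rw [sobolevInner, ← integral_complex_ofReal]
      refine integral_congr_ae (Eventually.of_forall fun l => ?_)
      simp only [← hu]
      rw [mul_assoc, Complex.mul_conj, Complex.normSq_eq_norm_sq, Complex.ofReal_mul]
    rw [sobolevNorm, h1, Complex.ofReal_re, Real.sq_sqrt]
    exact integral_nonneg fun l => by positivity
  have hn2 : l2Norm k (fun l => g l - u l) ^ 2 = ∫ l, ‖g l - u l‖ ^ 2 ∂(dunklMeasure k) := by
    rw [l2Norm, Real.sq_sqrt]
    exact integral_nonneg fun l => by positivity
  simp only [key]
  refine ⟨isum.sub ig', ?_⟩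
  have e := integral_sub isum ig'
  simp only [Pi.add_apply] at e
  rw [e, integral_add (iw.const_mul ρ) igu, integral_const_mul, tikhonov, ← hu, hn, hn2, tikhonovMin]
  ring

/-- The Tikhonov functional has a unique minimizer, with transform `g / (ρ (1 + l²)^s + 1)`. -/
theorem isExtremal_of_hasLCDT (hb : M 0 1 ≠ 0) {s ρ : ℝ} (hs : 0 ≤ s) (hρ : 0 < ρ) {g : ℝ → ℂ}
    (hg : MemLp g 2 (dunklMeasure k)) {T : 𝓢'(ℝ, ℂ)}
    (hT : HasLCDT k M T fun l => g l / (regDenom s ρ l : ℂ)) :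
    IsExtremal k M s ρ g T ∧ ∀ T', IsExtremal k M s ρ g T' → T' = T := by
  have hmem := mem_sobolevSpace_of_hasLCDT hs hρ hg hT
  have hd0 : ∀ l, 0 < regDenom s ρ l := fun l => by linarith [one_le_regDenom s hρ l]
  have hval : tikhonov k M s ρ g T = tikhonovMin k s ρ g := by
    rw [(tikhonov_eq hb hs hρ hg hmem).2]
    have hae := (hasLCDT_lcdtFun hT).ae_eq hb hT
    rw [integral_eq_zero_of_ae, add_zero]
    filter_upwards [hae] with l hl
    simp [hl]
  have hnn : ∀ (T' : 𝓢'(ℝ, ℂ)) (l : ℝ),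
      0 ≤ regDenom s ρ l * ‖lcdtFun k M T' l - g l / (regDenom s ρ l : ℂ)‖ ^ 2 := fun T' l =>
    mul_nonneg (hd0 l).le (by positivity)
  refine ⟨⟨hmem, isMinOn_iff.2 fun T' hT' => ?_⟩, fun T' hT' => ?_⟩
  · rw [hval, (tikhonov_eq hb hs hρ hg hT').2]
    have := integral_nonneg (μ := dunklMeasure k) (Pi.le_def.2 (hnn T'))
    linarith
  · have h1 := isMinOn_iff.1 hT'.2 T hmem
    obtain ⟨hi, he⟩ := tikhonov_eq hb hs hρ hg hT'.1
    rw [hval, he] at h1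
    have h2 := integral_nonneg (μ := dunklMeasure k) (Pi.le_def.2 (hnn T'))
    have h3 := (integral_eq_zero_iff_of_nonneg (Pi.le_def.2 (hnn T')) hi).1 (le_antisymm (by linarith) h2)
    refine (memLp_rpow_mul_lcdtFun hb hT'.1).1.distribution_eq hb hT ?_
    filter_upwards [h3] with l hl
    have hl' : regDenom s ρ l * ‖lcdtFun k M T' l - g l / (regDenom s ρ l : ℂ)‖ ^ 2 = 0 := hl
    rcases mul_eq_zero.1 hl' with h | h
    · exact absurd h (hd0 l).ne'
    · exact sub_eq_zero.1 (norm_eq_zero.1 (pow_eq_zero_iff two_ne_zero |>.1 h))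

theorem memLp_one_div_regDenom {s ρ : ℝ} (hs : (k + 1) / 2 < s) (hρ : 0 < ρ) :
    MemLp (fun l => ((1 / regDenom s ρ l : ℝ) : ℂ)) 2 (dunklMeasure k) := by
  have hd0 : ∀ l, 0 < regDenom s ρ l := fun l => by linarith [one_le_regDenom s hρ l]
  refine ((memLp_one_add_sq_rpow hs).const_mul ((1 / ρ : ℝ) : ℂ)).mono
    (Complex.continuous_ofReal.comp (continuous_const.div (continuous_regDenom s ρ)
      fun l => (hd0 l).ne')).aestronglyMeasurable (Eventually.of_forall fun l => ?_)
  have h := rpow_div_regDenom_le s hρ 0 l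
  have := hd0 l
  rw [norm_mul, Complex.norm_real, Complex.norm_real, Complex.norm_real,
    Real.norm_of_nonneg (by positivity), Real.norm_of_nonneg (by positivity),
    Real.norm_of_nonneg (by positivity)]
  simpa using h

/-- Both g and the reciprocal denominator are in L², so s > (k+1)/2 already suffices for a
continuous minimizer. -/
theorem integrable_div_regDenom {s ρ : ℝ} (hs : (k + 1) / 2 < s) (hρ : 0 < ρ) {g : ℝ → ℂ}
    (hg : MemLp g 2 (dunklMeasure k)) :
    Integrable (fun l => g l / (regDenom s ρ l : ℂ)) (dunklMeasure k) := by
  simp only [div_regDenom_eq_mul]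
  exact hg.integrable_mul (memLp_one_div_regDenom hs hρ)

/-- The denominator is real, so conj C conj E/m is the conjugate of the section's transform. -/
theorem lcdtInv_div_regDenom (hb : M 0 1 ≠ 0) {s ρ : ℝ} (g : ℝ → ℂ) {T : 𝓢'(ℝ, ℂ)} {y : ℝ}
    (hT : HasLCDT k M T (sectionTransform k M s ρ y)) :
    lcdtInv k M (fun l => g l / (regDenom s ρ l : ℂ)) y = l2Inner k g (lcdtFun k M T) := by
  rw [lcdtInv, l2Inner, ← integral_const_mul]
  refine integral_congr_ae ?_
  filter_upwards [(hasLCDT_lcdtFun hT).ae_eq hb hT] with l hl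
  rw [hl, sectionTransform, map_div₀, map_mul, Complex.conj_ofReal]
  ring

end

end LCDT

theorem mainTheorem7 (k : ℝ) (hk : -1 / 2 ≤ k) (M : Matrix.SpecialLinearGroup (Fin 2) ℝ)
    (hb : M 0 1 ≠ 0) (s : ℝ) (hs : (k + 1) / 2 < s) (ρ : ℝ) (hρ : 0 < ρ)
    (g : ℝ → ℂ) (hg : MemLp g 2 (LCDT.dunklMeasure k)) :
    ∃ κ : ℝ → 𝓢'(ℝ, ℂ),
      (∀ y, LCDT.IsKernelSection k M s ρ y (κ y)) ∧
      (∀ y, ∃ u, LCDT.HasLCDT k M (κ y) u ∧ MemLp u 2 (LCDT.dunklMeasure k)) ∧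
      (k + 1 < s → LCDT.IsReproducingKernel k M s ρ κ) ∧
      ∃ h : 𝓢'(ℝ, ℂ),
        LCDT.IsExtremal k M s ρ g h ∧
        (∀ h', LCDT.IsExtremal k M s ρ g h' → h' = h) ∧
        ∃ F : ℝ → ℂ, Continuous F ∧ LCDT.IsFunction k h F ∧
          ∀ y, F y = LCDT.l2Inner k g (LCDT.lcdtFun k M (κ y)) := by
  have : Fact (-1 / 2 ≤ k) := ⟨hk⟩
  have hs0 : 0 ≤ s := by linarith
  have hu := fun y => LCDT.memLp_sectionTransform (M := M) hs hρ y
  choose κ _ _ _ _ hκ using fun y => LCDT.exists_hasLCDT hb (hu y)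
  obtain ⟨h, -, -, -, -, hh⟩ := LCDT.exists_hasLCDT (k := k) hb
    (LCDT.memLp_div_regDenom (s := s) hρ hg)
  have hi := LCDT.integrable_div_regDenom hs hρ hg
  have hext := LCDT.isExtremal_of_hasLCDT hb hs0 hρ hg hh
  exact ⟨κ, fun y => LCDT.isKernelSection_of_hasLCDT hb hs hρ (hκ y), fun y => ⟨_, hκ y, hu y⟩,
    fun hs' => LCDT.isReproducingKernel_of_hasLCDT hb hs' hρ hκ, h, hext.1, hext.2, _,
    LCDT.continuous_lcdtInv hi, hh.isFunction hb hi,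
    fun y => LCDT.lcdtInv_div_regDenom hb g (hκ y)⟩
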